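/- Let $M_k$ be the complex $k\times k$ matrices with inner product $\langle C,D\rangle=\operatorname{tr}(CD^*)$, and identify $M_k\otimes M_m$ with $M_{km}$ via the Kronecker product. A matrix $A\in M_k\otimes M_m$ is - *PPT* if $A$ and its partial transpose $A^{t_1}$ (the image of $A$ under the linear map $C\otimes D\mapsto C^t\otimes D$) are positive semidefinite Hermitian; - *separable* if $A=\sum_{i} C_i\otimes D_i$ (a finite sum) with all $C_i\in M_k$, $D_i\in M_m$ positive semidefinite Hermitian; - *weak irreducible* if it is positive semidefinite Hermitian and, for all Hermitian projections $V_1,V_2\in M_k$ and $W_1,W_2\in M_m$ with $V_1V_2=0$, $W_1W_2=0$, $V_1+V_2=\mathrm{Id}$, $W_1+W_2=\mathrm{Id}$, the equality $A=\sum_{i=1}^2 (V_i\otimes W_i)A(V_i\otimes W_i)$ implies $(V_1\otimes W_1)A(V_1\otimes W_1)=0$ or $(V_2\otimes W_2)A(V_2\otimes W_2)=0$. A *Hermitian Schmidt decomposition* of $A$ is $A=\sum_{i=1}^n\lambda_i\gamma_i\otimes\delta_i$ with real $\lambda_i>0$ and Hermitian $\gamma_i\in M_k$, $\delta_i\in M_m$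 such that $(\gamma_i)_i$ and $(\delta_i)_i$ are orthonormal families. **Theorem.** (a) Let $A\in M_k\otimes M_m$ be a weak irreducible PPT matrix with a Hermitian Schmidt decomposition $\sum_{i=1}^n\lambda_i\gamma_i\otimes\delta_i$, where $n\ge1$ and $\lambda_1\ge\dots\ge\lambda_n>0$. Let $\mu$ be the least positive eigenvalue of $\gamma_1\otimes\delta_1$. If $$\frac{\lambda_1\mu}{\lambda_2+\dots+\lambda_n}\ge 1,\qquad\text{i.e. } \lambda_1\mu\ge\lambda_2+\dots+\lambda_n$$ (automatically satisfied when $n=1$), then $A$ is separable. (b) The constant $1$ in (a) cannot be replaced by any $l$ with $0<l<1$: for every such $l$ there are $k,m$, a weak irreducible PPT matrix $A\in M_k\otimes M_m$ and a Hermitian Schmidt decomposition of $A$ as in (a), with $\mu$ as in (a), such that $\frac{\lambda_1\mu}{\lambda_2+\dots+\lambda_n}\ge l$ (the denominator being nonzero) and $A$ is not separable. (c) For $n\ge 1$ let $\gamma_1=\frac{1}{\sqrt{n+1}}\mathrm{Id}\in M_{n+1}$ and $\gamma_2=\frac1{\sqrt{n^2+n}}\operatorname{diag}(n,-1,\dots,-1)\in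 M_{n+1}$. The least positive eigenvalue of $\gamma_1\otimes\gamma_1$ is $\mu=\frac1{n+1}$. For all $\lambda_1,\lambda_2>0$, the expression $A(n)=\lambda_1\gamma_1\otimes\gamma_1+\lambda_2\gamma_2\otimes(-\gamma_2)$ is a Hermitian Schmidt decomposition, and $A(n)$ is separable if and only if $\frac{\lambda_1\mu}{\lambda_2}\ge\frac{n^2}{n^2+n}$. For every $l$ with $0<l<1$ there is $n\ge1$ with $\frac{n^2}{n^2+n}>l$. -/

import Mathlib

open scoped Kronecker ComplexOrder

noncomputable section

/-- Elements of `M_k ⊗ M_m`, identified with `km × km` complex matrices via the Kronecker product. -/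
abbrev BipartiteMatrix (k m : ℕ) : Type := Matrix (Fin k × Fin m) (Fin k × Fin m) ℂ

/-- The partial transposition `A ↦ A^{t₁}` on the first factor: the linear map with
`C ⊗ D ↦ Cᵗ ⊗ D`. -/
def partialTranspose {k m : ℕ} (A : BipartiteMatrix k m) : BipartiteMatrix k m :=
  Matrix.of fun p q => A (q.1, p.2) (p.1, q.2)

theorem partialTranspose_kronecker {k m : ℕ} (C : Matrix (Fin k) (Fin k) ℂ)
    (D : Matrix (Fin m) (Fin m) ℂ) :
    partialTranspose (C ⊗ₖ D) = C.transpose ⊗ₖ D := by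
  ext p q
  simp [partialTranspose, Matrix.kroneckerMap_apply]

/-- Positive under partial transposition (`A` itself is positive semidefinite Hermitian too). -/
def IsPPT {k m : ℕ} (A : BipartiteMatrix k m) : Prop :=
  A.PosSemidef ∧ (partialTranspose A).PosSemidef

/-- A separable matrix: a finite sum of Kronecker products of positive semidefinite Hermitian
matrices. -/
def IsSeparableMatrix {k m : ℕ} (A : BipartiteMatrix k m) : Prop :=
  ∃ (n : ℕ) (C : Fin n → Matrix (Fin k) (Fin k) ℂ) (D : Fin n → Matrix (Fin m) (Fin m) ℂ),
    (∀ i, (C i).PosSemidef) ∧ (∀ i, (D i).PosSemidef) ∧ A = ∑ i, C i ⊗ₖ D i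

/-- Weak irreducibility of a positive semidefinite Hermitian matrix. -/
def IsWeakIrreducible {k m : ℕ} (A : BipartiteMatrix k m) : Prop :=
  A.PosSemidef ∧
  ∀ (V₁ V₂ : Matrix (Fin k) (Fin k) ℂ) (W₁ W₂ : Matrix (Fin m) (Fin m) ℂ),
    (V₁.IsHermitian ∧ V₁ * V₁ = V₁) → (V₂.IsHermitian ∧ V₂ * V₂ = V₂) →
    (W₁.IsHermitian ∧ W₁ * W₁ = W₁) → (W₂.IsHermitian ∧ W₂ * W₂ = W₂) →
    V₁ * V₂ = 0 → W₁ * W₂ = 0 → V₁ + V₂ = 1 → W₁ + W₂ = 1 →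
    A = (V₁ ⊗ₖ W₁) * A * (V₁ ⊗ₖ W₁) + (V₂ ⊗ₖ W₂) * A * (V₂ ⊗ₖ W₂) →
    (V₁ ⊗ₖ W₁) * A * (V₁ ⊗ₖ W₁) = 0 ∨ (V₂ ⊗ₖ W₂) * A * (V₂ ⊗ₖ W₂) = 0

/-- Orthonormality of a family of matrices for the inner product `⟨C, D⟩ = tr (C D*)`. -/
def IsOrthonormalFamily {k n : ℕ} (γ : Fin n → Matrix (Fin k) (Fin k) ℂ) : Prop :=
  ∀ i j, (γ i * (γ j).conjTranspose).trace = if i = j then 1 else 0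

/-- `A = ∑ λᵢ γᵢ ⊗ δᵢ` is a Hermitian Schmidt decomposition of `A`. -/
structure IsHermitianSchmidtDecomposition {k m n : ℕ} (A : BipartiteMatrix k m)
    (lam : Fin n → ℝ) (γ : Fin n → Matrix (Fin k) (Fin k) ℂ)
    (δ : Fin n → Matrix (Fin m) (Fin m) ℂ) : Prop where
  lam_pos : ∀ i, 0 < lam i
  hermitian_left : ∀ i, (γ i).IsHermitian
  hermitian_right : ∀ i, (δ i).IsHermitian
  orthonormal_left : IsOrthonormalFamily γ
  orthonormal_right : IsOrthonormalFamily δ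
  eq_sum : A = ∑ i, (lam i : ℂ) • (γ i ⊗ₖ δ i)

/-- `μ` is the least positive eigenvalue of `M`. -/
def IsLeastPositiveEigenvalue {k m : ℕ} (M : BipartiteMatrix k m) (μ : ℝ) : Prop :=
  IsLeast {x : ℝ | 0 < x ∧ Module.End.HasEigenvalue (Matrix.toLin' M) (x : ℂ)} μ

/-- The normalized identity matrix of order `n + 1`. -/
def normalizedOne (n : ℕ) : Matrix (Fin (n + 1)) (Fin (n + 1)) ℂ :=
  Matrix.diagonal fun _ => ((1 / Real.sqrt (n + 1) : ℝ) : ℂ)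

/-- The traceless matrix `diag (n, -1, …, -1) / √(n² + n)` of order `n + 1`. -/
def tracelessDiag (n : ℕ) : Matrix (Fin (n + 1)) (Fin (n + 1)) ℂ :=
  Matrix.diagonal fun i =>
    (((if i = 0 then (n : ℝ) else -1) / Real.sqrt ((n : ℝ) ^ 2 + n) : ℝ) : ℂ)

/-- The matrix `λ₁ γ₁ ⊗ γ₁ + λ₂ γ₂ ⊗ (-γ₂)` with `γ₁ = normalizedOne n`, `γ₂ = tracelessDiag n`. -/
def diagFamily (n : ℕ) (lam₁ lam₂ : ℝ) : BipartiteMatrix (n + 1) (n + 1) :=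
  (lam₁ : ℂ) • (normalizedOne n ⊗ₖ normalizedOne n) +
    (lam₂ : ℂ) • (tracelessDiag n ⊗ₖ (-tracelessDiag n))

end

/-! For (a), read `A` as the real bilinear form `(X, Y) ↦ tr (A (X ⊗ Y))` on Hermitian matrices. The
Schmidt coefficients are its singular values, and it is nonnegative on pairs of positive
semidefinite matrices, so a Perron–Frobenius argument applies. Splitting `γ₁` and `δ₁` into positive
and negative parts gives two pairs that both attain the top singular value
(`norm_eq_of_singularForm_parts`). For such a pair with support projections `V`, `W`, the form
vanishes on `(V, 1 - W)` and `(1 - V, W)`. Positivity of `A` and of its partial transpose then makes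
`A` block diagonal along `V ⊗ W` and `(1 - V) ⊗ (1 - W)` (`IsPPT.eq_add_of_trace_eq_zero`), and weak
irreducibility kills one block. Hence, up to a common sign, `γ₁` and `δ₁` are positive semidefinite,
and all `γᵢ`, `δᵢ` live on the supports `V`, `W` of `γ₁`, `δ₁`.

Since `γᵢ` and `δᵢ` have Hilbert–Schmidt norm one, `V ± γᵢ` and `W ± δᵢ` are positive semidefinite,
so `V ⊗ W + γᵢ ⊗ δᵢ` is separable. Each term `i ≥ 2` costs `λᵢ` copies of `V ⊗ W`, and `λ₁ γ₁ ⊗ δ₁`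
can supply at least `λ₁ μ` of them with a separable remainder.

For (b), the identity minus a multiple of the traceless term of (c) is perturbed by small couplings.
These put a vector in the kernel of `A` and another in the kernel of its partial transpose, chosen
so that no separable decomposition is compatible with both. The matrix has no nonzero product vector
in its kernel, which forces weak irreducibility. For (c), all matrices are diagonal, so separability
is nonnegativity of the entries. -/

/-- The matrix with eigenvalues `d` in the basis given by the columns of `U`. -/
noncomputable def diagonalConj {n : ℕ} (U : Matrix (Fin n) (Fin n) ℂ) (d : Fin n → ℝ) :
    Matrix (Fin n) (Fin n) ℂ :=
  U * Matrix.diagonal (fun i => (d i : ℂ)) * U.conjTranspose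

/-! ### Spectral calculus: positive and negative parts, support projections. -/

section diagonalConj

variable {n : ℕ} {U : Matrix (Fin n) (Fin n) ℂ}

theorem diagonalConj_mul (hU : U.conjTranspose * U = 1) (d e : Fin n → ℝ) :
    diagonalConj U d * diagonalConj U e = diagonalConj U (fun i => d i * e i) := by
  unfold diagonalConj
  calc _ = U * Matrix.diagonal (fun i => (d i : ℂ)) * (U.conjTranspose * U) *
        Matrix.diagonal (fun i => (e i : ℂ)) * U.conjTranspose := by
          simp only [Matrix.mul_assoc]
    _ = _ := by
      rw [hU, Matrix.mul_one, Matrix.mul_assoc U, Matrix.diagonal_mul_diagonal]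
      simp

theorem diagonalConj_sub (d e : Fin n → ℝ) :
    diagonalConj U d - diagonalConj U e = diagonalConj U (fun i => d i - e i) := by
  simp only [diagonalConj, ← Matrix.sub_mul, ← Matrix.mul_sub, Matrix.diagonal_sub,
    Complex.ofReal_sub]

theorem diagonalConj_add (d e : Fin n → ℝ) :
    diagonalConj U d + diagonalConj U e = diagonalConj U (fun i => d i + e i) := by
  simp only [diagonalConj, ← Matrix.add_mul, ← Matrix.mul_add, Matrix.diagonal_add,
    Complex.ofReal_add]

theorem diagonalConj_smul (c : ℝ) (d : Fin n → ℝ) :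
    (c : ℂ) • diagonalConj U d = diagonalConj U (fun i => c * d i) := by
  simp only [diagonalConj, Complex.ofReal_mul]
  rw [← Matrix.smul_mul, ← Matrix.mul_smul, ← Matrix.diagonal_smul]
  rfl

theorem diagonalConj_one (hU : U * U.conjTranspose = 1) :
    diagonalConj U (fun _ => 1) = 1 := by
  simp [diagonalConj, hU]

theorem diagonalConj_zero : diagonalConj U (fun _ => 0) = 0 := by
  simp [diagonalConj]

theorem posSemidef_diagonalConj {d : Fin n → ℝ} (hd : ∀ i, 0 ≤ d i) :
    (diagonalConj U d).PosSemidef := by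
  apply Matrix.PosSemidef.mul_mul_conjTranspose_same
  rw [Matrix.posSemidef_diagonal_iff]
  intro i
  exact_mod_cast hd i

theorem isHermitian_diagonalConj (d : Fin n → ℝ) : (diagonalConj U d).IsHermitian := by
  apply Matrix.isHermitian_mul_mul_conjTranspose
  rw [Matrix.isHermitian_diagonal_iff]
  intro i
  simp [IsSelfAdjoint]

theorem trace_diagonalConj (hU : U.conjTranspose * U = 1) (d : Fin n → ℝ) :
    (diagonalConj U d).trace = ((∑ i, d i : ℝ) : ℂ) := by
  rw [diagonalConj, Matrix.trace_mul_comm, ← Matrix.mul_assoc, hU, Matrix.one_mul,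
    Matrix.trace_diagonal]
  push_cast
  rfl

theorem diagonalConj_mulVec (hU : U.conjTranspose * U = 1) (d : Fin n → ℝ) (i : Fin n) :
    (diagonalConj U d).mulVec (U.mulVec (Pi.single i 1)) =
      (d i : ℂ) • U.mulVec (Pi.single i 1) := by
  rw [diagonalConj, Matrix.mulVec_mulVec, Matrix.mul_assoc, hU, Matrix.mul_one,
    ← Matrix.mulVec_mulVec, Matrix.diagonal_mulVec_single, ← Matrix.mulVec_smul]
  congr 1
  ext j
  simp [Pi.single_apply]

end diagonalConj

theorem Matrix.IsHermitian.exists_eq_diagonalConj {n : ℕ} {X : Matrix (Fin n) (Fin n) ℂ}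
    (hX : X.IsHermitian) :
    ∃ U : Matrix (Fin n) (Fin n) ℂ, U.conjTranspose * U = 1 ∧ U * U.conjTranspose = 1 ∧
      X = diagonalConj U hX.eigenvalues := by
  refine ⟨hX.eigenvectorUnitary, ?_, ?_, ?_⟩
  · exact Unitary.coe_star_mul_self _
  · exact Unitary.coe_mul_star_self _
  · exact hX.spectral_theorem

theorem Matrix.IsHermitian.exists_posSemidef_sub {n : ℕ} {X : Matrix (Fin n) (Fin n) ℂ}
    (hX : X.IsHermitian) :
    ∃ Y Z : Matrix (Fin n) (Fin n) ℂ, Y.PosSemidef ∧ Z.PosSemidef ∧ X = Y - Z ∧ Y * Z = 0 := by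
  obtain ⟨U, hU, -, h⟩ := hX.exists_eq_diagonalConj
  refine ⟨diagonalConj U (fun i => max (hX.eigenvalues i) 0),
    diagonalConj U (fun i => max (-hX.eigenvalues i) 0),
    posSemidef_diagonalConj fun i => le_max_right _ _,
    posSemidef_diagonalConj fun i => le_max_right _ _, ?_, ?_⟩
  · rw [diagonalConj_sub]
    conv_lhs => rw [h]
    congr 1
    ext i
    rcases le_total 0 (hX.eigenvalues i) with h | h <;> simp [h]
  · rw [diagonalConj_mul hU]
    convert diagonalConj_zero (U := U) using 2
    ext i
    rcases le_total 0 (hX.eigenvalues i) with h | h <;> simp [h]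

/-- `V` is the support projection of the positive semidefinite matrix `X`, and `c` is a lower
bound for the nonzero part of its spectrum. -/
structure IsSupport {n : ℕ} (X V : Matrix (Fin n) (Fin n) ℂ) (c : ℝ) : Prop where
  isHermitian : V.IsHermitian
  mul_self : V * V = V
  mul_left : V * X = X
  mul_right : X * V = X
  pos : 0 < c
  posSemidef_sub : (X - (c : ℂ) • V).PosSemidef
  mul_eq_zero : ∀ Z : Matrix (Fin n) (Fin n) ℂ, X * Z = 0 → V * Z = 0
  eigenvector : X ≠ 0 → ∃ v, v ≠ 0 ∧ X.mulVec v = (c : ℂ) • v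

theorem Matrix.PosSemidef.exists_isSupport {n : ℕ} {X : Matrix (Fin n) (Fin n) ℂ}
    (hX : X.PosSemidef) : ∃ V c, IsSupport X V c := by
  obtain ⟨U, hU, hU', h⟩ := hX.1.exists_eq_diagonalConj
  have hn := hX.eigenvalues_nonneg
  set e := hX.1.eigenvalues with he
  clear_value e
  have hc : ∃ c : ℝ, 0 < c ∧ (∀ i, e i ≠ 0 → c ≤ e i) ∧ ((∃ i, e i ≠ 0) → ∃ i, e i = c) := by
    by_cases hne : ∃ i, e i ≠ 0
    · obtain ⟨i₀, hi₀⟩ := hne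
      obtain ⟨i, hi, hmin⟩ := Finset.exists_min_image (Finset.univ.filter fun i => e i ≠ 0) e
        ⟨i₀, by simpa using hi₀⟩
      simp only [Finset.mem_filter, Finset.mem_univ, true_and] at hi hmin
      exact ⟨e i, lt_of_le_of_ne (hn i) (Ne.symm hi), hmin, fun _ => ⟨i, rfl⟩⟩
    -- This is the case `X = 0`, where any positive constant serves.
    · exact ⟨1, one_pos, fun i hi => (hne ⟨i, hi⟩).elim, fun h => (hne h).elim⟩
  obtain ⟨c, hc0, hc1, hc2⟩ := hc
  have key (f : Fin n → ℝ) (g : Fin n → ℝ) (hfg : ∀ i, f i = g i) :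
      diagonalConj U f = diagonalConj U g := by rw [funext hfg]
  refine ⟨diagonalConj U (fun i => if e i = 0 then 0 else 1), c,
    ⟨isHermitian_diagonalConj _, ?_, ?_, ?_, hc0, ?_, ?_, ?_⟩⟩
  · rw [diagonalConj_mul hU]
    exact key _ _ fun i => by split_ifs <;> simp
  · rw [h, diagonalConj_mul hU]
    exact key _ _ fun i => by split_ifs with hi <;> simp [hi]
  · rw [h, diagonalConj_mul hU]
    exact key _ _ fun i => by split_ifs with hi <;> simp [hi]
  · rw [h, diagonalConj_smul, diagonalConj_sub]
    refine posSemidef_diagonalConj fun i => ?_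
    split_ifs with hi
    · simp [hi]
    · simpa using hc1 i hi
  · intro Z hZ
    -- As `0⁻¹ = 0`, the inverted spectrum gives the pseudo-inverse of `X`, whose product with `X`
    -- is the support projection.
    have : diagonalConj U (fun i => if e i = 0 then 0 else 1) =
        diagonalConj U (fun i => (e i)⁻¹) * X := by
      rw [h, diagonalConj_mul hU]
      exact key _ _ fun i => by split_ifs with hi <;> simp [hi]
    rw [this, Matrix.mul_assoc, hZ, Matrix.mul_zero]
  · intro hX0
    have hne : ∃ i, e i ≠ 0 := by
      by_contra! hne
      apply hX0
      rw [h, key _ _ hne, diagonalConj_zero]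
    obtain ⟨i, hi⟩ := hc2 hne
    refine ⟨U.mulVec (Pi.single i 1), fun h0 => ?_, ?_⟩
    · have := congrArg (U.conjTranspose.mulVec) h0
      rw [Matrix.mulVec_mulVec, hU, Matrix.one_mulVec, Matrix.mulVec_zero] at this
      simpa using congrFun this i
    · rw [← hi, h, diagonalConj_mulVec hU]

/-- The squares of the eigenvalues sum to `1`, so every eigenvalue lies in `[-1, 1]`. -/
theorem Matrix.IsHermitian.posSemidef_one_add_sub {n : ℕ} {X : Matrix (Fin n) (Fin n) ℂ}
    (hX : X.IsHermitian) (h1 : (X * X).trace = 1) :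
    (1 + X).PosSemidef ∧ (1 - X).PosSemidef := by
  obtain ⟨U, hU, hU', h⟩ := hX.exists_eq_diagonalConj
  set e := hX.eigenvalues with he
  clear_value e
  rw [h, diagonalConj_mul hU, trace_diagonalConj hU] at h1
  have h1' : ∑ i, e i * e i = 1 := by exact_mod_cast h1
  have hb (i) : -1 ≤ e i ∧ e i ≤ 1 := by
    have : e i * e i ≤ 1 := by
      rw [← h1']
      exact Finset.single_le_sum (f := fun i => e i * e i) (fun j _ => mul_self_nonneg _)
        (Finset.mem_univ i)
    constructor <;> nlinarith
  rw [h, ← diagonalConj_one hU', diagonalConj_add, diagonalConj_sub]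
  exact ⟨posSemidef_diagonalConj fun i => by linarith [hb i],
    posSemidef_diagonalConj fun i => by linarith [hb i]⟩

/-! ### Hermitian matrices as a real inner product space. -/

/-- A matrix as a vector of the Euclidean space with the Hilbert–Schmidt norm. -/
noncomputable def hsVec {k : ℕ} (X : Matrix (Fin k) (Fin k) ℂ) :
    EuclideanSpace ℂ (Fin k × Fin k) :=
  WithLp.toLp 2 fun p => X p.1 p.2

theorem hsVec_injective {k : ℕ} : Function.Injective (hsVec (k := k)) := by
  intro X Y h
  ext i j
  exact congrArg (fun v : EuclideanSpace ℂ (Fin k × Fin k) => v (i, j)) h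

theorem hsVec_sub {k : ℕ} (X Y : Matrix (Fin k) (Fin k) ℂ) :
    hsVec (X - Y) = hsVec X - hsVec Y := rfl

theorem inner_hsVec {k : ℕ} (X Y : Matrix (Fin k) (Fin k) ℂ) :
    inner ℝ (hsVec X) (hsVec Y) = (Y * X.conjTranspose).trace.re := by
  simp only [PiLp.inner_apply, hsVec, Matrix.trace, Matrix.mul_apply,
    Matrix.diag, Matrix.conjTranspose_apply, Fintype.sum_prod_type, Complex.re_sum]
  rfl

theorem Matrix.IsHermitian.trace_mul_im {k : ℕ} {X Y : Matrix (Fin k) (Fin k) ℂ}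
    (hX : X.IsHermitian) (hY : Y.IsHermitian) : (X * Y).trace.im = 0 := by
  have h : star (X * Y).trace = (X * Y).trace := by
    rw [← Matrix.trace_conjTranspose, Matrix.conjTranspose_mul, hX.eq, hY.eq,
      Matrix.trace_mul_comm]
  exact Complex.conj_eq_iff_im.mp h

/-- The trace of a product of two Hermitian matrices is real, so the real inner product loses
nothing. -/
theorem Matrix.IsHermitian.trace_mul_eq_inner {k : ℕ} {X Y : Matrix (Fin k) (Fin k) ℂ}
    (hX : X.IsHermitian) (hY : Y.IsHermitian) :
    (X * Y).trace = (inner ℝ (hsVec X) (hsVec Y) : ℝ) := by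
  apply Complex.ext
  · rw [Complex.ofReal_re, inner_hsVec, hX.eq, Matrix.trace_mul_comm]
  · rw [hX.trace_mul_im hY, Complex.ofReal_im]

theorem IsOrthonormalFamily.orthonormal {k n : ℕ} {γ : Fin n → Matrix (Fin k) (Fin k) ℂ}
    (h : IsOrthonormalFamily γ) : Orthonormal ℝ fun i => hsVec (γ i) := by
  rw [orthonormal_iff_ite]
  intro i j
  rw [inner_hsVec, h j i]
  by_cases hij : i = j
  · simp [hij]
  · simp [hij, Ne.symm hij]

/-! ### The top singular value of a bilinear form. -/

section SingularValue

variable {E F : Type*} [NormedAddCommGroup E] [InnerProductSpace ℝ E]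
  [NormedAddCommGroup F] [InnerProductSpace ℝ F] {n : ℕ}

/-- The bilinear form with singular values `lam` and singular vectors `g`, `d`. -/
noncomputable def singularForm (lam : Fin (n + 1) → ℝ) (g : Fin (n + 1) → E)
    (d : Fin (n + 1) → F) (x : E) (y : F) : ℝ :=
  ∑ i, lam i * (inner ℝ (g i) x * inner ℝ (d i) y)

variable {lam : Fin (n + 1) → ℝ} {g : Fin (n + 1) → E} {d : Fin (n + 1) → F}

theorem sum_sq_inner_le (hg : Orthonormal ℝ g) (x : E) : ∑ i, inner ℝ (g i) x ^ 2 ≤ ‖x‖ ^ 2 := by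
  have := hg.sum_inner_products_le x (s := Finset.univ)
  simpa [Real.norm_eq_abs, sq_abs] using this

theorem singularForm_le (hpos : ∀ i, 0 < lam i) (hmono : Antitone lam) (hg : Orthonormal ℝ g)
    (hd : Orthonormal ℝ d) (x : E) (y : F) :
    singularForm lam g d x y ≤ lam 0 * (‖x‖ * ‖y‖) := by
  have h1 : singularForm lam g d x y ≤
      ∑ i, lam 0 * (|inner ℝ (g i) x| * |inner ℝ (d i) y|) := by
    refine Finset.sum_le_sum fun i _ => ?_
    calc _ ≤ lam i * (|inner ℝ (g i) x| * |inner ℝ (d i) y|) := by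
          rw [← abs_mul]
          exact mul_le_mul_of_nonneg_left (le_abs_self _) (hpos i).le
      _ ≤ _ := mul_le_mul_of_nonneg_right (hmono (Fin.zero_le i)) (by positivity)
  refine h1.trans ?_
  rw [← Finset.mul_sum]
  refine mul_le_mul_of_nonneg_left ?_ (hpos 0).le
  have h2 := Finset.sum_mul_sq_le_sq_mul_sq Finset.univ (fun i => |inner ℝ (g i) x|)
    (fun i => |inner ℝ (d i) y|)
  simp only [sq_abs] at h2
  refine abs_le_of_sq_le_sq' (h2.trans ?_) (by positivity) |>.2
  rw [mul_pow]
  exact mul_le_mul (sum_sq_inner_le hg x) (sum_sq_inner_le hd y)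
    (Finset.sum_nonneg fun i _ => sq_nonneg _) (sq_nonneg _)

theorem singularForm_comm (x : E) (y : F) :
    singularForm lam g d x y = singularForm lam d g y x := by
  simp only [singularForm, mul_comm]

/-- Equality case of the Cauchy–Schwarz bound: the vector `w` representing `singularForm lam g d x`
has norm at most `lam 0 * ‖x‖`, and expanding `‖w - lam 0 • y‖ ^ 2` then gives at most `0`. -/
theorem sum_smul_eq_of_singularForm_eq (hpos : ∀ i, 0 < lam i) (hmono : Antitone lam)
    (hg : Orthonormal ℝ g) (hd : Orthonormal ℝ d) {x : E} {y : F} (hxy : ‖x‖ = ‖y‖)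
    (h : singularForm lam g d x y = lam 0 * ‖x‖ ^ 2) (z : F) :
    singularForm lam g d x z = lam 0 * inner ℝ y z := by
  set w : F := ∑ i, (lam i * inner ℝ (g i) x) • d i with hw
  have hwz (z : F) : inner ℝ w z = singularForm lam g d x z := by
    simp only [hw, sum_inner, inner_smul_left, singularForm, conj_trivial, mul_assoc]
  have hww : inner ℝ w w ≤ lam 0 ^ 2 * ‖x‖ ^ 2 := by
    have : inner ℝ w w = ∑ i, lam i ^ 2 * inner ℝ (g i) x ^ 2 := by
      rw [hw, hd.inner_sum]
      exact Finset.sum_congr rfl fun i _ => by simp; ring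
    rw [this]
    calc _ ≤ ∑ i, lam 0 ^ 2 * inner ℝ (g i) x ^ 2 := by
          refine Finset.sum_le_sum fun i _ => mul_le_mul_of_nonneg_right ?_ (sq_nonneg _)
          exact pow_le_pow_left₀ (hpos i).le (hmono (Fin.zero_le i)) 2
      _ ≤ _ := by
        rw [← Finset.mul_sum]
        exact mul_le_mul_of_nonneg_left (sum_sq_inner_le hg x) (sq_nonneg _)
  have h0 : inner ℝ (w - lam 0 • y) (w - lam 0 • y) ≤ 0 := by
    rw [inner_sub_left, inner_sub_right, inner_sub_right, inner_smul_left, inner_smul_left,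
      inner_smul_right, inner_smul_right, real_inner_comm w y, hwz y, h,
      real_inner_self_eq_norm_sq y, ← hxy]
    simp only [conj_trivial]
    nlinarith
  have h1 : w = lam 0 • y := sub_eq_zero.mp (real_inner_self_nonpos.mp h0)
  rw [← hwz, h1, inner_smul_left]
  rfl

/-- Perron–Frobenius step. The form equals `lam 0` at `(x - x', y - y')`; dropping the nonnegative
cross terms leaves `lam 0 ≤ lam 0 * (‖x‖ * ‖y‖ + ‖x'‖ * ‖y'‖)`. As `‖x‖ ^ 2 + ‖x'‖ ^ 2 = 1 = ‖y‖ ^ 2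
+ ‖y'‖ ^ 2`, every inequality used is an equality. -/
theorem norm_eq_of_singularForm_parts (hpos : ∀ i, 0 < lam i) (hmono : Antitone lam)
    (hg : Orthonormal ℝ g) (hd : Orthonormal ℝ d) {x x' : E} {y y' : F}
    (hx : g 0 = x - x') (hy : d 0 = y - y') (hxx : inner ℝ x x' = 0) (hyy : inner ℝ y y' = 0)
    (h1 : 0 ≤ singularForm lam g d x y') (h2 : 0 ≤ singularForm lam g d x' y) :
    (‖x‖ = ‖y‖ ∧ singularForm lam g d x y = lam 0 * ‖x‖ ^ 2) ∧
    (‖x'‖ = ‖y'‖ ∧ singularForm lam g d x' y' = lam 0 * ‖x'‖ ^ 2) := by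
  have htot : singularForm lam g d x y + singularForm lam g d x' y' -
      singularForm lam g d x y' - singularForm lam g d x' y = lam 0 := by
    have : singularForm lam g d (g 0) (d 0) = lam 0 := by
      unfold singularForm
      rw [Finset.sum_eq_single 0]
      · simp [hg.1, hd.1]
      · intro i _ hi
        simp [hg.2 hi]
      · simp
    rw [← this]
    conv_rhs => rw [hx, hy]
    simp only [singularForm, ← Finset.sum_add_distrib, ← Finset.sum_sub_distrib, inner_sub_right]
    exact Finset.sum_congr rfl fun i _ => by ring
  have hnx : ‖x‖ ^ 2 + ‖x'‖ ^ 2 = 1 := by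
    have := hg.1 0
    rw [hx] at this
    have h := norm_sub_sq_real x x'
    rw [this, hxx] at h
    linarith
  have hny : ‖y‖ ^ 2 + ‖y'‖ ^ 2 = 1 := by
    have := hd.1 0
    rw [hy] at this
    have h := norm_sub_sq_real y y'
    rw [this, hyy] at h
    linarith
  have hb := singularForm_le hpos hmono hg hd x y
  have hb' := singularForm_le hpos hmono hg hd x' y'
  have hl := hpos 0
  have h3 : 1 ≤ ‖x‖ * ‖y‖ + ‖x'‖ * ‖y'‖ := by
    by_contra! h
    nlinarith
  have h4 : (‖x‖ - ‖y‖) ^ 2 + (‖x'‖ - ‖y'‖) ^ 2 ≤ 0 := by nlinarith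
  have e1 : ‖x‖ = ‖y‖ := by nlinarith [sq_nonneg (‖x‖ - ‖y‖), sq_nonneg (‖x'‖ - ‖y'‖)]
  have e2 : ‖x'‖ = ‖y'‖ := by nlinarith [sq_nonneg (‖x‖ - ‖y‖), sq_nonneg (‖x'‖ - ‖y'‖)]
  rw [← e1, ← sq] at hb
  rw [← e2, ← sq] at hb'
  have h5 : lam 0 * ‖x‖ ^ 2 + lam 0 * ‖x'‖ ^ 2 = lam 0 := by rw [← mul_add, hnx, mul_one]
  exact ⟨⟨e1, by linarith⟩, e2, by linarith⟩

end SingularValue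

/-! ### Traces against positive semidefinite matrices and partial transposition. -/

section Splitting

variable {k m : ℕ}

open scoped MatrixOrder in
theorem Matrix.PosSemidef.exists_eq_conjTranspose_mul_self {n : Type*} [Fintype n]
    {A : Matrix n n ℂ} (hA : A.PosSemidef) : ∃ B : Matrix n n ℂ, A = B.conjTranspose * B := by
  classical
  exact CStarAlgebra.nonneg_iff_eq_star_mul_self.mp hA.nonneg

/-- Writing `A = Bᴴ B`, the trace of `A * P` is the squared Hilbert–Schmidt norm of `B * P`. -/
theorem Matrix.PosSemidef.mul_eq_zero_of_trace {n : Type*} [Fintype n]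
    {A P : Matrix n n ℂ} (hA : A.PosSemidef) (hP : P.IsHermitian) (hPP : P * P = P)
    (h : (A * P).trace = 0) : A * P = 0 := by
  obtain ⟨B, rfl⟩ := hA.exists_eq_conjTranspose_mul_self
  have : B * P = 0 := by
    rw [← Matrix.trace_conjTranspose_mul_self_eq_zero_iff, Matrix.conjTranspose_mul, hP.eq,
      Matrix.mul_assoc, Matrix.trace_mul_comm, Matrix.mul_assoc, Matrix.mul_assoc, hPP,
      ← Matrix.mul_assoc, h]
  rw [Matrix.mul_assoc, this, Matrix.mul_zero]

theorem Matrix.PosSemidef.trace_mul_nonneg {n : Type*} [Fintype n]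
    {A B : Matrix n n ℂ} (hA : A.PosSemidef) (hB : B.PosSemidef) : 0 ≤ (A * B).trace := by
  obtain ⟨C, rfl⟩ := hB.exists_eq_conjTranspose_mul_self
  rw [← Matrix.mul_assoc, Matrix.trace_mul_comm, ← Matrix.mul_assoc]
  exact (hA.mul_mul_conjTranspose_same C).trace_nonneg

theorem Finset.sum_swap_first_third {ι κ M : Type*} [Fintype ι] [Fintype κ] [AddCommMonoid M]
    (f : ι → κ → ι → κ → M) :
    ∑ a, ∑ b, ∑ c, ∑ e, f a b c e = ∑ a, ∑ b, ∑ c, ∑ e, f c b a e := by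
  calc _ = ∑ a, ∑ c, ∑ b, ∑ e, f a b c e := Finset.sum_congr rfl fun a _ => Finset.sum_comm
    _ = ∑ c, ∑ a, ∑ b, ∑ e, f a b c e := Finset.sum_comm
    _ = _ := Finset.sum_congr rfl fun a _ => Finset.sum_comm

theorem partialTranspose_mul (A : BipartiteMatrix k m) (V V' : Matrix (Fin k) (Fin k) ℂ)
    (W W' : Matrix (Fin m) (Fin m) ℂ) :
    partialTranspose ((V ⊗ₖ W) * A * (V' ⊗ₖ W')) =
      (V'.transpose ⊗ₖ W) * partialTranspose A * (V.transpose ⊗ₖ W') := by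
  ext ⟨a, b⟩ ⟨c, e⟩
  simp only [partialTranspose, Matrix.of_apply, Matrix.mul_apply, Matrix.kroneckerMap_apply,
    Matrix.transpose_apply, Fintype.sum_prod_type, Finset.sum_mul]
  rw [Finset.sum_swap_first_third]
  iterate 4 refine Finset.sum_congr rfl fun _ _ => ?_
  ring

theorem trace_partialTranspose_mul (A : BipartiteMatrix k m) (V : Matrix (Fin k) (Fin k) ℂ)
    (W : Matrix (Fin m) (Fin m) ℂ) :
    (partialTranspose A * (V.transpose ⊗ₖ W)).trace = (A * (V ⊗ₖ W)).trace := by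
  simp only [partialTranspose, Matrix.of_apply, Matrix.mul_apply, Matrix.kroneckerMap_apply,
    Matrix.transpose_apply, Fintype.sum_prod_type, Matrix.trace, Matrix.diag]
  rw [Finset.sum_swap_first_third]

end Splitting

theorem Matrix.sub_kronecker {k m : ℕ} (X Y : Matrix (Fin k) (Fin k) ℂ)
    (Z : Matrix (Fin m) (Fin m) ℂ) : (X - Y) ⊗ₖ Z = X ⊗ₖ Z - Y ⊗ₖ Z := by
  ext p q
  simp [Matrix.kroneckerMap_apply, sub_mul]

theorem Matrix.kronecker_sub {k m : ℕ} (X : Matrix (Fin k) (Fin k) ℂ)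
    (Y Z : Matrix (Fin m) (Fin m) ℂ) : X ⊗ₖ (Y - Z) = X ⊗ₖ Y - X ⊗ₖ Z := by
  ext p q
  simp [Matrix.kroneckerMap_apply, mul_sub]

/-! ### The cone of separable matrices. -/

section Separable

variable {k m : ℕ}

theorem IsSeparableMatrix.of_fintype {ι : Type*} [Fintype ι] {A : BipartiteMatrix k m}
    (C : ι → Matrix (Fin k) (Fin k) ℂ) (D : ι → Matrix (Fin m) (Fin m) ℂ)
    (hC : ∀ i, (C i).PosSemidef) (hD : ∀ i, (D i).PosSemidef) (hA : A = ∑ i, C i ⊗ₖ D i) :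
    IsSeparableMatrix A := by
  let e := Fintype.equivFin ι
  refine ⟨Fintype.card ι, fun i => C (e.symm i), fun i => D (e.symm i), fun i => hC _,
    fun i => hD _, ?_⟩
  rw [hA]
  exact (Equiv.sum_comp e.symm fun i => C i ⊗ₖ D i).symm

theorem IsSeparableMatrix.kronecker {C : Matrix (Fin k) (Fin k) ℂ} {D : Matrix (Fin m) (Fin m) ℂ}
    (hC : C.PosSemidef) (hD : D.PosSemidef) : IsSeparableMatrix (C ⊗ₖ D) :=
  .of_fintype (fun _ : Unit => C) (fun _ => D) (fun _ => hC) (fun _ => hD) (by simp)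

theorem IsSeparableMatrix.sum {ι : Type*} [Fintype ι] {A : ι → BipartiteMatrix k m}
    (h : ∀ i, IsSeparableMatrix (A i)) : IsSeparableMatrix (∑ i, A i) := by
  choose n C D hC hD hA using h
  refine .of_fintype (ι := Σ i, Fin (n i)) (fun p => C p.1 p.2) (fun p => D p.1 p.2)
    (fun p => hC _ _) (fun p => hD _ _) ?_
  rw [Fintype.sum_sigma]
  exact Finset.sum_congr rfl fun i _ => hA i

theorem IsSeparableMatrix.add {A B : BipartiteMatrix k m} (hA : IsSeparableMatrix A)
    (hB : IsSeparableMatrix B) : IsSeparableMatrix (A + B) := by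
  have := IsSeparableMatrix.sum (A := ![A, B]) (by
    intro i
    fin_cases i
    exacts [hA, hB])
  simpa using this

theorem IsSeparableMatrix.smul {A : BipartiteMatrix k m} (hA : IsSeparableMatrix A) {c : ℝ}
    (hc : 0 ≤ c) : IsSeparableMatrix ((c : ℂ) • A) := by
  obtain ⟨n, C, D, hC, hD, rfl⟩ := hA
  refine ⟨n, fun i => (c : ℂ) • C i, D, fun i => (hC i).smul (by exact_mod_cast hc), hD, ?_⟩
  simp only [Finset.smul_sum, Matrix.smul_kronecker]

/-- The sum is half of `(V + γ) ⊗ (W + δ) + (V - γ) ⊗ (W - δ)`, since the mixed terms cancel. -/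
theorem isSeparableMatrix_kronecker_add_kronecker {V γ : Matrix (Fin k) (Fin k) ℂ}
    {W δ : Matrix (Fin m) (Fin m) ℂ} (hV : (V + γ).PosSemidef) (hV' : (V - γ).PosSemidef)
    (hW : (W + δ).PosSemidef) (hW' : (W - δ).PosSemidef) :
    IsSeparableMatrix (V ⊗ₖ W + γ ⊗ₖ δ) := by
  have := ((IsSeparableMatrix.kronecker hV hW).add (.kronecker hV' hW')).smul
    (c := 1 / 2) (by norm_num)
  convert this using 1
  simp only [Matrix.add_kronecker, Matrix.kronecker_add, Matrix.sub_kronecker,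
    Matrix.kronecker_sub]
  push_cast
  module

end Separable

/-! ### Block splitting of a weak irreducible PPT matrix. -/

section Splitting

variable {k m : ℕ}

theorem Matrix.IsHermitian.kronecker' {X : Matrix (Fin k) (Fin k) ℂ}
    {Y : Matrix (Fin m) (Fin m) ℂ} (hX : X.IsHermitian) (hY : Y.IsHermitian) :
    (X ⊗ₖ Y).IsHermitian := by
  rw [Matrix.IsHermitian, Matrix.conjTranspose_kronecker, hX.eq, hY.eq]

/-- Positivity of `A` removes the blocks on `V ⊗ (1 - W)` and `(1 - V) ⊗ W`, but not the coupling
between `V ⊗ W` and `(1 - V) ⊗ (1 - W)`. Under partial transposition that coupling acquires a factor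
`Vᵗ ⊗ (1 - W)`, which the positive semidefinite partial transpose of `A` annihilates. -/
theorem IsPPT.eq_add_of_trace_eq_zero {A : BipartiteMatrix k m} (hA : IsPPT A)
    {V : Matrix (Fin k) (Fin k) ℂ} {W : Matrix (Fin m) (Fin m) ℂ}
    (hV : V.IsHermitian) (hVV : V * V = V) (hW : W.IsHermitian) (hWW : W * W = W)
    (h1 : (A * (V ⊗ₖ (1 - W))).trace = 0) (h2 : (A * ((1 - V) ⊗ₖ W)).trace = 0) :
    A = (V ⊗ₖ W) * A * (V ⊗ₖ W) + ((1 - V) ⊗ₖ (1 - W)) * A * ((1 - V) ⊗ₖ (1 - W)) := by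
  have hV' : (1 - V).IsHermitian := Matrix.isHermitian_one.sub hV
  have hW' : (1 - W).IsHermitian := Matrix.isHermitian_one.sub hW
  have hVV' : (1 - V) * (1 - V) = 1 - V := by
    rw [Matrix.mul_sub, Matrix.sub_mul, Matrix.sub_mul, hVV]; simp
  have hWW' : (1 - W) * (1 - W) = 1 - W := by
    rw [Matrix.mul_sub, Matrix.sub_mul, Matrix.sub_mul, hWW]; simp
  have hsq {X : Matrix (Fin k) (Fin k) ℂ} {Y : Matrix (Fin m) (Fin m) ℂ} (hX : X * X = X)
      (hY : Y * Y = Y) : (X ⊗ₖ Y) * (X ⊗ₖ Y) = X ⊗ₖ Y := by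
    rw [← Matrix.mul_kronecker_mul, hX, hY]
  have e1 : A * (V ⊗ₖ (1 - W)) = 0 :=
    hA.1.mul_eq_zero_of_trace (hV.kronecker' hW') (hsq hVV hWW') h1
  have e2 : A * ((1 - V) ⊗ₖ W) = 0 :=
    hA.1.mul_eq_zero_of_trace (hV'.kronecker' hW) (hsq hVV' hWW) h2
  have adj {X : BipartiteMatrix k m} (hX : X.IsHermitian) (h : A * X = 0) : X * A = 0 := by
    have := congrArg Matrix.conjTranspose h
    rwa [Matrix.conjTranspose_mul, hX.eq, hA.1.1.eq, Matrix.conjTranspose_zero] at this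
  have e3 : partialTranspose A * (V.transpose ⊗ₖ (1 - W)) = 0 := by
    refine hA.2.mul_eq_zero_of_trace (hV.transpose.kronecker' hW') (hsq ?_ hWW') ?_
    · rw [← Matrix.transpose_mul, hVV]
    · rw [trace_partialTranspose_mul, h1]
  have e4 : (V ⊗ₖ W) * A * ((1 - V) ⊗ₖ (1 - W)) = 0 := by
    have h : partialTranspose ((V ⊗ₖ W) * A * ((1 - V) ⊗ₖ (1 - W))) = 0 := by
      rw [partialTranspose_mul, Matrix.mul_assoc, e3, Matrix.mul_zero]
    ext p q
    simpa [partialTranspose] using congrFun (congrFun h (q.1, p.2)) (p.1, q.2)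
  have e5 : ((1 - V) ⊗ₖ (1 - W)) * A * (V ⊗ₖ W) = 0 := by
    have := congrArg Matrix.conjTranspose e4
    rwa [Matrix.conjTranspose_mul, Matrix.conjTranspose_mul, hA.1.1.eq, (hV.kronecker' hW).eq,
      (hV'.kronecker' hW').eq, Matrix.conjTranspose_zero, ← Matrix.mul_assoc] at this
  have hone : (1 : BipartiteMatrix k m) = V ⊗ₖ W + (1 - V) ⊗ₖ (1 - W) + V ⊗ₖ (1 - W) +
      (1 - V) ⊗ₖ W := by
    rw [← Matrix.one_kronecker_one]
    simp only [Matrix.kronecker_sub, Matrix.sub_kronecker]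
    abel
  have hr : A = A * (V ⊗ₖ W) + A * ((1 - V) ⊗ₖ (1 - W)) := by
    conv_lhs => rw [← Matrix.mul_one A, hone]
    rw [Matrix.mul_add, Matrix.mul_add, Matrix.mul_add, e1, e2, add_zero, add_zero]
  have hl : A = (V ⊗ₖ W) * A + ((1 - V) ⊗ₖ (1 - W)) * A := by
    conv_lhs => rw [← Matrix.one_mul A, hone]
    rw [Matrix.add_mul, Matrix.add_mul, Matrix.add_mul, adj (hV.kronecker' hW') e1,
      adj (hV'.kronecker' hW) e2, add_zero, add_zero]
  conv_lhs => rw [hl, hr]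
  simp only [Matrix.mul_add, ← Matrix.mul_assoc, e4, e5, add_zero, zero_add]

/-- As `X ≥ c V` with `c > 0`, a vanishing trace against `X ⊗ Z` bounds the nonnegative trace
against `V ⊗ Z` by zero. -/
theorem trace_mul_kronecker_eq_zero_of_isSupport_left {A : BipartiteMatrix k m}
    (hA : A.PosSemidef) {X V : Matrix (Fin k) (Fin k) ℂ} {c : ℝ} (hV : IsSupport X V c)
    (hVp : V.PosSemidef) {Z : Matrix (Fin m) (Fin m) ℂ} (hZ : Z.PosSemidef)
    (h : (A * (X ⊗ₖ Z)).trace = 0) : (A * (V ⊗ₖ Z)).trace = 0 := by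
  have h1 := hA.trace_mul_nonneg (hV.posSemidef_sub.kronecker hZ)
  have h2 := hA.trace_mul_nonneg (hVp.kronecker hZ)
  rw [Matrix.sub_kronecker, Matrix.mul_sub, Matrix.trace_sub, h, Matrix.smul_kronecker,
    Matrix.mul_smul, Matrix.trace_smul, smul_eq_mul, zero_sub] at h1
  have hc : (0 : ℂ) < c := by exact_mod_cast hV.pos
  exact (mul_eq_zero.mp (le_antisymm (neg_nonneg.mp h1) (mul_nonneg hc.le h2))).resolve_left hc.ne'

theorem trace_mul_kronecker_eq_zero_of_isSupport_right {A : BipartiteMatrix k m}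
    (hA : A.PosSemidef) {X V : Matrix (Fin m) (Fin m) ℂ} {c : ℝ} (hV : IsSupport X V c)
    (hVp : V.PosSemidef) {Z : Matrix (Fin k) (Fin k) ℂ} (hZ : Z.PosSemidef)
    (h : (A * (Z ⊗ₖ X)).trace = 0) : (A * (Z ⊗ₖ V)).trace = 0 := by
  have h1 := hA.trace_mul_nonneg (hZ.kronecker hV.posSemidef_sub)
  have h2 := hA.trace_mul_nonneg (hZ.kronecker hVp)
  rw [Matrix.kronecker_sub, Matrix.mul_sub, Matrix.trace_sub, h, Matrix.kronecker_smul,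
    Matrix.mul_smul, Matrix.trace_smul, smul_eq_mul, zero_sub] at h1
  have hc : (0 : ℂ) < c := by exact_mod_cast hV.pos
  exact (mul_eq_zero.mp (le_antisymm (neg_nonneg.mp h1) (mul_nonneg hc.le h2))).resolve_left hc.ne'

theorem Matrix.IsHermitian.posSemidef_of_mul_self {n : ℕ} {V : Matrix (Fin n) (Fin n) ℂ}
    (hV : V.IsHermitian) (hVV : V * V = V) : V.PosSemidef := by
  have := Matrix.posSemidef_conjTranspose_mul_self V
  rwa [hV.eq, hVV] at this

theorem Matrix.IsHermitian.posSemidef_one_sub_of_mul_self {n : ℕ} {V : Matrix (Fin n) (Fin n) ℂ}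
    (hV : V.IsHermitian) (hVV : V * V = V) : (1 - V).PosSemidef := by
  refine (Matrix.isHermitian_one.sub hV).posSemidef_of_mul_self ?_
  rw [Matrix.mul_sub, Matrix.sub_mul, Matrix.sub_mul, hVV]
  simp

/-- A pair of positive semidefinite matrices that corresponds to the singular value `l` of the
bilinear form of `A` splits `A` along its supports. -/
theorem IsWeakIrreducible.eq_add_of_isSupport {A : BipartiteMatrix k m} (hw : IsWeakIrreducible A)
    (hA : IsPPT A) {X V : Matrix (Fin k) (Fin k) ℂ} {Y W : Matrix (Fin m) (Fin m) ℂ}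
    {a b l : ℝ} (hV : IsSupport X V a) (hW : IsSupport Y W b)
    (h1 : ∀ Z : Matrix (Fin m) (Fin m) ℂ, Z.IsHermitian →
      (A * (X ⊗ₖ Z)).trace = l * (Y * Z).trace)
    (h2 : ∀ Z : Matrix (Fin k) (Fin k) ℂ, Z.IsHermitian →
      (A * (Z ⊗ₖ Y)).trace = l * (X * Z).trace) :
    A = (V ⊗ₖ W) * A * (V ⊗ₖ W) + ((1 - V) ⊗ₖ (1 - W)) * A * ((1 - V) ⊗ₖ (1 - W)) ∧
    ((V ⊗ₖ W) * A * (V ⊗ₖ W) = 0 ∨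
      ((1 - V) ⊗ₖ (1 - W)) * A * ((1 - V) ⊗ₖ (1 - W)) = 0) := by
  have hVp := hV.isHermitian.posSemidef_of_mul_self hV.mul_self
  have hWp := hW.isHermitian.posSemidef_of_mul_self hW.mul_self
  have hVp' := hV.isHermitian.posSemidef_one_sub_of_mul_self hV.mul_self
  have hWp' := hW.isHermitian.posSemidef_one_sub_of_mul_self hW.mul_self
  have e1 : (A * (V ⊗ₖ (1 - W))).trace = 0 := by
    refine trace_mul_kronecker_eq_zero_of_isSupport_left hA.1 hV hVp hWp' ?_
    -- The singular vector relation turns this trace into `l * tr (Y (1 - W))`, which vanishes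
    -- because `W` supports `Y`.
    rw [h1 _ hWp'.1, Matrix.mul_sub, hW.mul_right, Matrix.mul_one, sub_self]
    simp
  have e2 : (A * ((1 - V) ⊗ₖ W)).trace = 0 := by
    refine trace_mul_kronecker_eq_zero_of_isSupport_right hA.1 hW hWp hVp' ?_
    rw [h2 _ hVp'.1, Matrix.mul_sub, hV.mul_right, Matrix.mul_one, sub_self]
    simp
  have hs := hA.eq_add_of_trace_eq_zero hV.isHermitian hV.mul_self hW.isHermitian hW.mul_self
    e1 e2
  refine ⟨hs, hw.2 V (1 - V) W (1 - W) ⟨hV.isHermitian, hV.mul_self⟩ ⟨hVp'.1, ?_⟩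
    ⟨hW.isHermitian, hW.mul_self⟩ ⟨hWp'.1, ?_⟩ ?_ ?_ ?_ ?_ hs⟩
  · rw [Matrix.mul_sub, Matrix.sub_mul, Matrix.sub_mul, hV.mul_self]; simp
  · rw [Matrix.mul_sub, Matrix.sub_mul, Matrix.sub_mul, hW.mul_self]; simp
  · rw [Matrix.mul_sub, hV.mul_self]; simp
  · rw [Matrix.mul_sub, hW.mul_self]; simp
  · abel
  · abel

theorem trace_mul_eq_zero_of_conj_eq_zero {n : Type*} [Fintype n] {A P Z : Matrix n n ℂ}
    (h : P * A * P = 0) (hZ : P * Z * P = Z) : (A * Z).trace = 0 := by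
  rw [← hZ, ← Matrix.mul_assoc, Matrix.trace_mul_comm, ← Matrix.mul_assoc, ← Matrix.mul_assoc,
    h, Matrix.zero_mul, Matrix.trace_zero]

end Splitting

/-! ### Schmidt vectors of weak irreducible PPT matrices and the separability bound. -/

section SchmidtDecomposition

variable {k m n : ℕ} {A : BipartiteMatrix k m} {lam : Fin (n + 1) → ℝ}
  {γ : Fin (n + 1) → Matrix (Fin k) (Fin k) ℂ} {δ : Fin (n + 1) → Matrix (Fin m) (Fin m) ℂ}

theorem IsHermitianSchmidtDecomposition.trace_mul_kronecker
    (h : IsHermitianSchmidtDecomposition A lam γ δ) {X : Matrix (Fin k) (Fin k) ℂ}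
    {Y : Matrix (Fin m) (Fin m) ℂ} (hX : X.IsHermitian) (hY : Y.IsHermitian) :
    (A * (X ⊗ₖ Y)).trace = (singularForm lam (fun i => hsVec (γ i)) (fun i => hsVec (δ i))
      (hsVec X) (hsVec Y) : ℝ) := by
  rw [h.eq_sum, Finset.sum_mul, Matrix.trace_sum, singularForm, Complex.ofReal_sum]
  refine Finset.sum_congr rfl fun i _ => ?_
  rw [Matrix.smul_mul, Matrix.trace_smul, ← Matrix.mul_kronecker_mul, Matrix.trace_kronecker,
    (h.hermitian_left i).trace_mul_eq_inner hX, (h.hermitian_right i).trace_mul_eq_inner hY]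
  simp

theorem IsHermitianSchmidtDecomposition.neg (h : IsHermitianSchmidtDecomposition A lam γ δ) :
    IsHermitianSchmidtDecomposition A lam (fun i => -γ i) (fun i => -δ i) where
  lam_pos := h.lam_pos
  hermitian_left i := (h.hermitian_left i).neg
  hermitian_right i := (h.hermitian_right i).neg
  orthonormal_left i j := by simpa using h.orthonormal_left i j
  orthonormal_right i j := by simpa using h.orthonormal_right i j
  eq_sum := by
    rw [h.eq_sum]
    refine Finset.sum_congr rfl fun i _ => ?_
    congr 1
    ext p q
    simp [Matrix.kroneckerMap_apply]

theorem IsHermitianSchmidtDecomposition.posSemidef_or_neg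
    (h : IsHermitianSchmidtDecomposition A lam γ δ) (hmono : Antitone lam)
    (hw : IsWeakIrreducible A) (hA : IsPPT A) :
    ((γ 0).PosSemidef ∧ (δ 0).PosSemidef) ∨ ((-γ 0).PosSemidef ∧ (-δ 0).PosSemidef) := by
  obtain ⟨X, X', hX, hX', hXX, hXX0⟩ := (h.hermitian_left 0).exists_posSemidef_sub
  obtain ⟨Y, Y', hY, hY', hYY, hYY0⟩ := (h.hermitian_right 0).exists_posSemidef_sub
  have hg := h.orthonormal_left.orthonormal
  have hd := h.orthonormal_right.orthonormal
  have hnn {S : Matrix (Fin k) (Fin k) ℂ} {T : Matrix (Fin m) (Fin m) ℂ} (hS : S.PosSemidef)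
      (hT : T.PosSemidef) : 0 ≤ singularForm lam (fun i => hsVec (γ i)) (fun i => hsVec (δ i))
        (hsVec S) (hsVec T) := by
    have := hA.1.trace_mul_nonneg (hS.kronecker hT)
    rw [h.trace_mul_kronecker hS.1 hT.1] at this
    exact_mod_cast this
  have hin {l : ℕ} {S T : Matrix (Fin l) (Fin l) ℂ} (hS : S.PosSemidef) (hT : T.PosSemidef)
      (h0 : S * T = 0) : inner ℝ (hsVec S) (hsVec T) = 0 := by
    have := hS.1.trace_mul_eq_inner hT.1
    rw [h0, Matrix.trace_zero] at this
    exact_mod_cast this.symm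
  obtain ⟨⟨n1, e1⟩, n2, e2⟩ := norm_eq_of_singularForm_parts h.lam_pos hmono hg hd
    (by rw [hXX, hsVec_sub]) (by rw [hYY, hsVec_sub]) (hin hX hX' hXX0) (hin hY hY' hYY0)
    (hnn hX hY') (hnn hX' hY)
  have hzero {S : Matrix (Fin k) (Fin k) ℂ} {T : Matrix (Fin m) (Fin m) ℂ} (hS : S.PosSemidef)
      (hT : T.PosSemidef) (hn : ‖hsVec S‖ = ‖hsVec T‖)
      (he : singularForm lam (fun i => hsVec (γ i)) (fun i => hsVec (δ i))
        (hsVec S) (hsVec T) = lam 0 * ‖hsVec S‖ ^ 2) (h0 : (A * (S ⊗ₖ T)).trace = 0) :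
      S = 0 ∧ T = 0 := by
    rw [h.trace_mul_kronecker hS.1 hT.1, he] at h0
    have h1 : ‖hsVec S‖ = 0 := by
      have : lam 0 * ‖hsVec S‖ ^ 2 = 0 := by exact_mod_cast h0
      simpa [(h.lam_pos 0).ne'] using this
    have h2 : ‖hsVec T‖ = 0 := by rw [← hn, h1]
    exact ⟨hsVec_injective (norm_eq_zero.mp h1), hsVec_injective (norm_eq_zero.mp h2)⟩
  obtain ⟨V, a, hV⟩ := hX.exists_isSupport
  obtain ⟨W, b, hW⟩ := hY.exists_isSupport
  have hsp := hw.eq_add_of_isSupport hA (l := lam 0) hV hW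
    (fun Z hZ => by
      rw [h.trace_mul_kronecker hX.1 hZ, hY.1.trace_mul_eq_inner hZ,
        sum_smul_eq_of_singularForm_eq h.lam_pos hmono hg hd n1 e1]
      push_cast
      rfl)
    (fun Z hZ => by
      rw [h.trace_mul_kronecker hZ hY.1, hX.1.trace_mul_eq_inner hZ, singularForm_comm,
        sum_smul_eq_of_singularForm_eq h.lam_pos hmono hd hg n1.symm
          (by rw [singularForm_comm, e1, n1])]
      push_cast
      rfl)
  -- The positive parts live in the first block and the negative parts in the second. The form takes
  -- the value `lam 0` times the squared norm on each pair, so a vanishing block forces its pair to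
  -- be zero.
  rcases hsp.2 with h0 | h0
  · right
    obtain ⟨hX0, hY0⟩ := hzero hX hY n1 e1 (trace_mul_eq_zero_of_conj_eq_zero h0 (by
      rw [← Matrix.mul_kronecker_mul, ← Matrix.mul_kronecker_mul, hV.mul_left, hV.mul_right,
        hW.mul_left, hW.mul_right]))
    rw [hXX, hYY, hX0, hY0]
    simpa using ⟨hX', hY'⟩
  · left
    have hc {l : ℕ} {S T P : Matrix (Fin l) (Fin l) ℂ} {c : ℝ} (hT : T.PosSemidef)
        (hP : IsSupport S P c) (h0 : S * T = 0) : (1 - P) * T * (1 - P) = T := by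
      have h1 := hP.mul_eq_zero T h0
      have h2 : T * P = 0 := by
        have := congrArg Matrix.conjTranspose h1
        rwa [Matrix.conjTranspose_mul, hT.1.eq, hP.isHermitian.eq,
          Matrix.conjTranspose_zero] at this
      rw [Matrix.sub_mul, h1, Matrix.one_mul, sub_zero, Matrix.mul_sub, h2, Matrix.mul_one,
        sub_zero]
    obtain ⟨hX0, hY0⟩ := hzero hX' hY' n2 e2 (trace_mul_eq_zero_of_conj_eq_zero h0 (by
      rw [← Matrix.mul_kronecker_mul, ← Matrix.mul_kronecker_mul, hc hX' hV hXX0,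
        hc hY' hW hYY0]))
    rw [hXX, hYY, hX0, hY0]
    simpa using ⟨hX, hY⟩

theorem singularForm_left {E F : Type*} [NormedAddCommGroup E] [InnerProductSpace ℝ E]
    [NormedAddCommGroup F] [InnerProductSpace ℝ F] {g : Fin (n + 1) → E} {d : Fin (n + 1) → F}
    (hg : Orthonormal ℝ g) (j : Fin (n + 1)) (y : F) :
    singularForm lam g d (g j) y = lam j * inner ℝ (d j) y := by
  unfold singularForm
  rw [Finset.sum_eq_single j]
  · simp [hg.1]
  · intro i _ hi
    simp [hg.2 hi]
  · simp

theorem IsHermitianSchmidtDecomposition.eq_conj_of_posSemidef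
    (h : IsHermitianSchmidtDecomposition A lam γ δ)
    (hw : IsWeakIrreducible A) (hA : IsPPT A) (hγ : (γ 0).PosSemidef) (hδ : (δ 0).PosSemidef)
    {V : Matrix (Fin k) (Fin k) ℂ} {W : Matrix (Fin m) (Fin m) ℂ} {a b : ℝ}
    (hV : IsSupport (γ 0) V a) (hW : IsSupport (δ 0) W b) :
    A = (V ⊗ₖ W) * A * (V ⊗ₖ W) := by
  have hg := h.orthonormal_left.orthonormal
  have hd := h.orthonormal_right.orthonormal
  obtain ⟨e, h0 | h0⟩ := hw.eq_add_of_isSupport hA (l := lam 0) hV hW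
    (fun Z hZ => by
      rw [h.trace_mul_kronecker hγ.1 hZ, hδ.1.trace_mul_eq_inner hZ, singularForm_left hg]
      push_cast
      rfl)
    (fun Z hZ => by
      rw [h.trace_mul_kronecker hZ hδ.1, hγ.1.trace_mul_eq_inner hZ, singularForm_comm,
        singularForm_left hd]
      push_cast
      rfl)
  -- The block on `V ⊗ W` cannot vanish: the form takes the value `lam 0 > 0` at `(γ 0, δ 0)`, which
  -- lives there.
  · have := trace_mul_eq_zero_of_conj_eq_zero (Z := γ 0 ⊗ₖ δ 0) h0 (by
      rw [← Matrix.mul_kronecker_mul, ← Matrix.mul_kronecker_mul, hV.mul_left, hV.mul_right,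
        hW.mul_left, hW.mul_right])
    rw [h.trace_mul_kronecker hγ.1 hδ.1, singularForm_left hg, real_inner_self_eq_norm_sq,
      hd.1 0] at this
    have h1 : lam 0 * 1 ^ 2 = 0 := by exact_mod_cast this
    linarith [h.lam_pos 0]
  · rwa [h0, add_zero] at e

/-- Contraction of the second tensor factor against `D`. -/
noncomputable def hsContract (A : BipartiteMatrix k m) (D : Matrix (Fin m) (Fin m) ℂ) :
    Matrix (Fin k) (Fin k) ℂ :=
  Matrix.of fun i j => ∑ b, ∑ c, A (i, b) (j, c) * D c b

theorem hsContract_sum_smul_kronecker {ι : Type*} [Fintype ι] (c : ι → ℂ)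
    (C : ι → Matrix (Fin k) (Fin k) ℂ) (D : ι → Matrix (Fin m) (Fin m) ℂ)
    (E : Matrix (Fin m) (Fin m) ℂ) :
    hsContract (∑ i, c i • (C i ⊗ₖ D i)) E = ∑ i, (c i * (D i * E).trace) • C i := by
  ext a a'
  simp only [hsContract, Matrix.of_apply, Matrix.sum_apply, Matrix.smul_apply,
    Matrix.kroneckerMap_apply, smul_eq_mul, Finset.sum_mul, Matrix.trace, Matrix.diag,
    Matrix.mul_apply, Finset.mul_sum]
  rw [eq_comm, Finset.sum_comm]
  refine Finset.sum_congr rfl fun b _ => ?_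
  rw [Finset.sum_comm]
  iterate 2 refine Finset.sum_congr rfl fun _ _ => ?_
  ring

/-- Contracting the sum against `δ j` isolates `lam j • γ j`; on the other side every contraction
has the form `V * _ * V`, which conjugation by the idempotent `V` fixes. -/
theorem conj_eq_of_sum_kronecker_eq (hpos : ∀ i, 0 < lam i) (hδ : IsOrthonormalFamily δ)
    {V : Matrix (Fin k) (Fin k) ℂ} {W : Matrix (Fin m) (Fin m) ℂ} (hVV : V * V = V)
    (e : ∑ i, (lam i : ℂ) • (γ i ⊗ₖ δ i) =
      ∑ i, (lam i : ℂ) • ((V * γ i * V) ⊗ₖ (W * δ i * W))) (j : Fin (n + 1)) :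
    V * γ j * V = γ j := by
  have h1 : hsContract (∑ i, (lam i : ℂ) • (γ i ⊗ₖ δ i)) (δ j).conjTranspose =
      (lam j : ℂ) • γ j := by
    rw [hsContract_sum_smul_kronecker, Finset.sum_eq_single j]
    · simp [hδ j j]
    · intro i _ hi
      simp [hδ i j, hi]
    · simp
  have h2 : V * ((lam j : ℂ) • γ j) * V = (lam j : ℂ) • γ j := by
    rw [← h1, e, hsContract_sum_smul_kronecker, Finset.mul_sum, Finset.sum_mul]
    refine Finset.sum_congr rfl fun i _ => ?_
    rw [Matrix.mul_smul, Matrix.smul_mul]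
    congr 1
    calc _ = (V * V) * γ i * (V * V) := by simp only [Matrix.mul_assoc]
      _ = _ := by rw [hVV]
  rw [Matrix.mul_smul, Matrix.smul_mul] at h2
  exact smul_right_injective _ (by exact_mod_cast (hpos j).ne' : (lam j : ℂ) ≠ 0) h2

theorem IsHermitianSchmidtDecomposition.conj_eq
    (h : IsHermitianSchmidtDecomposition A lam γ δ)
    {V : Matrix (Fin k) (Fin k) ℂ} {W : Matrix (Fin m) (Fin m) ℂ} (hVV : V * V = V)
    (hWW : W * W = W) (hA : A = (V ⊗ₖ W) * A * (V ⊗ₖ W)) (j : Fin (n + 1)) :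
    V * γ j * V = γ j ∧ W * δ j * W = δ j := by
  have e : ∑ i, (lam i : ℂ) • (γ i ⊗ₖ δ i) =
      ∑ i, (lam i : ℂ) • ((V * γ i * V) ⊗ₖ (W * δ i * W)) := by
    rw [← h.eq_sum]
    conv_lhs => rw [hA, h.eq_sum]
    rw [Finset.mul_sum, Finset.sum_mul]
    refine Finset.sum_congr rfl fun i _ => ?_
    rw [Matrix.mul_smul, Matrix.smul_mul, Matrix.mul_kronecker_mul, Matrix.mul_kronecker_mul]
  refine ⟨conj_eq_of_sum_kronecker_eq h.lam_pos h.orthonormal_right hVV e j,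
    conj_eq_of_sum_kronecker_eq h.lam_pos h.orthonormal_left hWW (W := V) ?_ j⟩
  ext p q
  have := congrFun (congrFun e (p.2, p.1)) (q.2, q.1)
  simp only [Matrix.sum_apply, Matrix.smul_apply, Matrix.kroneckerMap_apply] at this ⊢
  simpa only [mul_comm] using this

theorem IsOrthonormalFamily.posSemidef_add_sub {γ : Fin n → Matrix (Fin k) (Fin k) ℂ}
    (h : IsOrthonormalFamily γ) {i : Fin n} (hγ : (γ i).IsHermitian)
    {V : Matrix (Fin k) (Fin k) ℂ} (hV : V.IsHermitian) (hVV : V * V = V)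
    (hi : V * γ i * V = γ i) : (V + γ i).PosSemidef ∧ (V - γ i).PosSemidef := by
  have h1 := h i i
  rw [hγ.eq, if_pos rfl] at h1
  obtain ⟨hp, hm⟩ := hγ.posSemidef_one_add_sub h1
  have ep := hp.mul_mul_conjTranspose_same V
  have em := hm.mul_mul_conjTranspose_same V
  rw [hV.eq, Matrix.mul_add, Matrix.add_mul, Matrix.mul_one, hVV, hi] at ep
  rw [hV.eq, Matrix.mul_sub, Matrix.sub_mul, Matrix.mul_one, hVV, hi] at em
  exact ⟨ep, em⟩

/-- The product `a * b` is itself a positive eigenvalue of `X ⊗ Y`, with the product of the two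
eigenvectors. -/
theorem IsLeastPositiveEigenvalue.le_mul {X V : Matrix (Fin k) (Fin k) ℂ}
    {Y W : Matrix (Fin m) (Fin m) ℂ} {a b μ : ℝ} (hμ : IsLeastPositiveEigenvalue (X ⊗ₖ Y) μ)
    (hV : IsSupport X V a) (hW : IsSupport Y W b) (hX : X ≠ 0) (hY : Y ≠ 0) : μ ≤ a * b := by
  refine hμ.2 ⟨mul_pos hV.pos hW.pos, ?_⟩
  obtain ⟨v, hv, hXv⟩ := hV.eigenvector hX
  obtain ⟨w, hw, hYw⟩ := hW.eigenvector hY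
  refine Module.End.hasEigenvalue_of_hasEigenvector (x := fun p => v p.1 * w p.2) ⟨?_, ?_⟩
  · rw [Module.End.mem_eigenspace_iff, Matrix.toLin'_apply]
    ext p
    have h1 := congrFun hXv p.1
    have h2 := congrFun hYw p.2
    simp only [Matrix.mulVec, dotProduct, Pi.smul_apply, smul_eq_mul] at h1 h2
    simp only [Matrix.mulVec, dotProduct, Pi.smul_apply, smul_eq_mul, Matrix.kroneckerMap_apply,
      Fintype.sum_prod_type]
    calc _ = (∑ i, X p.1 i * v i) * ∑ j, Y p.2 j * w j := by
          rw [Finset.sum_mul_sum]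
          iterate 2 refine Finset.sum_congr rfl fun _ _ => ?_
          ring
      _ = _ := by
        rw [h1, h2]
        push_cast
        ring
  · obtain ⟨i, hi⟩ := Function.ne_iff.mp hv
    obtain ⟨j, hj⟩ := Function.ne_iff.mp hw
    exact Function.ne_iff.mpr ⟨(i, j), mul_ne_zero hi hj⟩

theorem IsHermitianSchmidtDecomposition.isSeparableMatrix_of_posSemidef
    (h : IsHermitianSchmidtDecomposition A lam γ δ) (hw : IsWeakIrreducible A) (hA : IsPPT A)
    (hγ : (γ 0).PosSemidef) (hδ : (δ 0).PosSemidef) {μ : ℝ}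
    (hμ : IsLeastPositiveEigenvalue (γ 0 ⊗ₖ δ 0) μ)
    (hle : ∑ i : Fin n, lam i.succ ≤ lam 0 * μ) : IsSeparableMatrix A := by
  obtain ⟨V, a, hV⟩ := hγ.exists_isSupport
  obtain ⟨W, b, hW⟩ := hδ.exists_isSupport
  have hVp := hV.isHermitian.posSemidef_of_mul_self hV.mul_self
  have hWp := hW.isHermitian.posSemidef_of_mul_self hW.mul_self
  have hconj := h.conj_eq hV.mul_self hW.mul_self (h.eq_conj_of_posSemidef hw hA hγ hδ hV hW)
  have hγ0 : γ 0 ≠ 0 := fun h0 => by simpa [h0] using h.orthonormal_left 0 0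
  have hδ0 : δ 0 ≠ 0 := fun h0 => by simpa [h0] using h.orthonormal_right 0 0
  have hμab := hμ.le_mul hV hW hγ0 hδ0
  -- Two successive subtractions, of `a V` from `γ 0` and of `b W` from `δ 0`, extract `lam 0 * (a *
  -- b)` copies of `V ⊗ W`. Of these, `lam i.succ` copies go to each remaining term; the leftover
  -- coefficient is nonnegative because `μ ≤ a * b`.
  have hs : IsSeparableMatrix (((lam 0 * (a * b) - ∑ i : Fin n, lam i.succ : ℝ) : ℂ) • (V ⊗ₖ W) +
      (lam 0 : ℂ) • ((γ 0 - (a : ℂ) • V) ⊗ₖ δ 0 + (a : ℂ) • (V ⊗ₖ (δ 0 - (b : ℂ) • W))) +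
      ∑ i : Fin n, (lam i.succ : ℂ) • (V ⊗ₖ W + γ i.succ ⊗ₖ δ i.succ)) := by
    refine .add (.add (.smul (.kronecker hVp hWp) ?_) (.smul (.add (.kronecker hV.posSemidef_sub hδ)
      (.smul (.kronecker hVp hW.posSemidef_sub) hV.pos.le)) (h.lam_pos 0).le))
      (.sum fun i => .smul ?_ (h.lam_pos _).le)
    · have := mul_le_mul_of_nonneg_left hμab (h.lam_pos 0).le
      linarith
    · obtain ⟨h1, h2⟩ := h.orthonormal_left.posSemidef_add_sub (h.hermitian_left i.succ)
        hV.isHermitian hV.mul_self (hconj i.succ).1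
      obtain ⟨h3, h4⟩ := h.orthonormal_right.posSemidef_add_sub (h.hermitian_right i.succ)
        hW.isHermitian hW.mul_self (hconj i.succ).2
      exact isSeparableMatrix_kronecker_add_kronecker h1 h2 h3 h4
  convert hs using 1
  rw [h.eq_sum, Fin.sum_univ_succ]
  simp only [smul_add, Finset.sum_add_distrib, Matrix.sub_kronecker, Matrix.kronecker_sub,
    Matrix.smul_kronecker, Matrix.kronecker_smul, ← Finset.sum_smul]
  push_cast
  module

theorem IsWeakIrreducible.isSeparableMatrix_of_sum_le (hw : IsWeakIrreducible A) (hA : IsPPT A)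
    (h : IsHermitianSchmidtDecomposition A lam γ δ) (hmono : Antitone lam) {μ : ℝ}
    (hμ : IsLeastPositiveEigenvalue (γ 0 ⊗ₖ δ 0) μ)
    (hle : ∑ i : Fin n, lam i.succ ≤ lam 0 * μ) : IsSeparableMatrix A := by
  rcases h.posSemidef_or_neg hmono hw hA with ⟨hγ, hδ⟩ | ⟨hγ, hδ⟩
  · exact h.isSeparableMatrix_of_posSemidef hw hA hγ hδ hμ hle
  -- Negating both Schmidt families changes neither `A` nor `γ 0 ⊗ δ 0`.
  · refine h.neg.isSeparableMatrix_of_posSemidef hw hA hγ hδ ?_ hle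
    convert hμ using 1
    ext p q
    simp [Matrix.kroneckerMap_apply]

end SchmidtDecomposition

/-! ### The diagonal family of part (c). -/

section DiagonalFamily

variable {n : ℕ}

theorem normalizedOne_kronecker_normalizedOne (n : ℕ) :
    normalizedOne n ⊗ₖ normalizedOne n =
      ((1 / ((n : ℝ) + 1) : ℝ) : ℂ) • (1 : BipartiteMatrix (n + 1) (n + 1)) := by
  have h : (1 / Real.sqrt (n + 1)) * (1 / Real.sqrt (n + 1)) = 1 / ((n : ℝ) + 1) := by
    rw [div_mul_div_comm, Real.mul_self_sqrt (by positivity), one_mul]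
  rw [normalizedOne, Matrix.diagonal_kronecker_diagonal, Matrix.smul_one_eq_diagonal, ← h]
  push_cast
  rfl

theorem isLeastPositiveEigenvalue_normalizedOne (n : ℕ) :
    IsLeastPositiveEigenvalue (normalizedOne n ⊗ₖ normalizedOne n) (1 / ((n : ℝ) + 1)) := by
  rw [normalizedOne_kronecker_normalizedOne]
  set c : ℝ := 1 / ((n : ℝ) + 1) with hc
  have hmul (v : Fin (n + 1) × Fin (n + 1) → ℂ) :
      Matrix.toLin' ((c : ℂ) • (1 : BipartiteMatrix (n + 1) (n + 1))) v = (c : ℂ) • v := by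
    simp [Matrix.smul_mulVec]
  refine ⟨⟨by positivity, ?_⟩, fun x hx => ?_⟩
  · refine Module.End.hasEigenvalue_of_hasEigenvector (x := fun _ => 1) ⟨?_, ?_⟩
    · rw [Module.End.mem_eigenspace_iff, hmul]
    · exact Function.ne_iff.mpr ⟨(0, 0), one_ne_zero⟩
  · obtain ⟨v, hv⟩ := hx.2.exists_hasEigenvector
    have h1 := hv.apply_eq_smul
    rw [hmul] at h1
    exact le_of_eq (by exact_mod_cast smul_left_injective ℂ hv.2 h1)

theorem isHermitian_normalizedOne (n : ℕ) : (normalizedOne n).IsHermitian := by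
  rw [normalizedOne, Matrix.isHermitian_diagonal_iff]
  intro i
  simp [IsSelfAdjoint]

theorem isHermitian_tracelessDiag (n : ℕ) : (tracelessDiag n).IsHermitian := by
  rw [tracelessDiag, Matrix.isHermitian_diagonal_iff]
  intro i
  simp only [IsSelfAdjoint, Complex.star_def, Complex.conj_ofReal]

theorem trace_normalizedOne_mul_self (n : ℕ) :
    (normalizedOne n * normalizedOne n).trace = 1 := by
  have h : ((n : ℝ) + 1) * ((1 / Real.sqrt (n + 1)) * (1 / Real.sqrt (n + 1))) = 1 := by
    rw [div_mul_div_comm, Real.mul_self_sqrt (by positivity)]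
    field_simp
  rw [normalizedOne, Matrix.diagonal_mul_diagonal, Matrix.trace_diagonal, Finset.sum_const,
    Finset.card_univ, Fintype.card_fin, nsmul_eq_mul]
  exact_mod_cast congrArg Complex.ofReal h

theorem trace_normalizedOne_mul_tracelessDiag (n : ℕ) :
    (normalizedOne n * tracelessDiag n).trace = 0 := by
  rw [normalizedOne, tracelessDiag, Matrix.diagonal_mul_diagonal, Matrix.trace_diagonal,
    ← Finset.mul_sum, ← Complex.ofReal_sum, ← Finset.sum_div, Fin.sum_univ_succ]
  simp [Fin.succ_ne_zero]

theorem trace_tracelessDiag_mul_self (hn : 1 ≤ n) :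
    (tracelessDiag n * tracelessDiag n).trace = 1 := by
  have hn' : (0 : ℝ) < n := by exact_mod_cast hn
  have hs : Real.sqrt ((n : ℝ) ^ 2 + n) * Real.sqrt ((n : ℝ) ^ 2 + n) = (n : ℝ) ^ 2 + n :=
    Real.mul_self_sqrt (by positivity)
  rw [tracelessDiag, Matrix.diagonal_mul_diagonal, Matrix.trace_diagonal]
  simp only [← Complex.ofReal_mul, ← Complex.ofReal_sum, div_mul_div_comm, hs]
  rw [← Finset.sum_div, Fin.sum_univ_succ]
  simp only [Fin.succ_ne_zero, if_false, if_true, Finset.sum_const, Finset.card_univ,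
    Fintype.card_fin, nsmul_eq_mul]
  rw [Complex.ofReal_eq_one]
  field_simp

theorem isHermitianSchmidtDecomposition_diagFamily (hn : 1 ≤ n) {lam₁ lam₂ : ℝ} (h₁ : 0 < lam₁)
    (h₂ : 0 < lam₂) :
    IsHermitianSchmidtDecomposition (diagFamily n lam₁ lam₂) ![lam₁, lam₂]
      ![normalizedOne n, tracelessDiag n] ![normalizedOne n, -tracelessDiag n] := by
  have t := trace_normalizedOne_mul_tracelessDiag n
  have t' : (tracelessDiag n * normalizedOne n).trace = 0 := by rw [Matrix.trace_mul_comm, t]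
  refine ⟨?_, ?_, ?_, ?_, ?_, ?_⟩
  · simp [Fin.forall_fin_two, h₁, h₂]
  · simp [Fin.forall_fin_two, isHermitian_normalizedOne, isHermitian_tracelessDiag]
  · simpa [Fin.forall_fin_two, isHermitian_normalizedOne] using (isHermitian_tracelessDiag n).neg
  · simp [IsOrthonormalFamily, Fin.forall_fin_two, (isHermitian_normalizedOne n).eq,
      (isHermitian_tracelessDiag n).eq, trace_normalizedOne_mul_self, t, t',
      trace_tracelessDiag_mul_self hn]
  · simp [IsOrthonormalFamily, Fin.forall_fin_two, (isHermitian_normalizedOne n).eq,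
      (isHermitian_tracelessDiag n).eq, trace_normalizedOne_mul_self, t, t',
      trace_tracelessDiag_mul_self hn]
  · simp [diagFamily]

/-- The diagonal of `√(n² + n) • tracelessDiag n`. -/
def tracelessVec (n : ℕ) (i : Fin (n + 1)) : ℝ := if i = 0 then n else -1

theorem tracelessDiag_kronecker_neg (n : ℕ) :
    tracelessDiag n ⊗ₖ (-tracelessDiag n) = Matrix.diagonal fun p =>
      ((-(tracelessVec n p.1 * tracelessVec n p.2) / ((n : ℝ) ^ 2 + n) : ℝ) : ℂ) := by
  have hs : Real.sqrt ((n : ℝ) ^ 2 + n) * Real.sqrt ((n : ℝ) ^ 2 + n) = (n : ℝ) ^ 2 + n :=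
    Real.mul_self_sqrt (by positivity)
  rw [tracelessDiag, Matrix.diagonal_neg, Matrix.diagonal_kronecker_diagonal]
  congr 1
  ext p
  conv_rhs => rw [← hs, neg_div, ← div_mul_div_comm]
  simp only [tracelessVec, Complex.ofReal_neg, Complex.ofReal_mul, mul_neg]

theorem diagFamily_eq_diagonal (n : ℕ) (lam₁ lam₂ : ℝ) :
    diagFamily n lam₁ lam₂ = Matrix.diagonal fun p =>
      ((lam₁ * (1 / ((n : ℝ) + 1)) -
        lam₂ * (tracelessVec n p.1 * tracelessVec n p.2 / ((n : ℝ) ^ 2 + n)) : ℝ) : ℂ) := by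
  rw [diagFamily, normalizedOne_kronecker_normalizedOne, tracelessDiag_kronecker_neg,
    Matrix.smul_one_eq_diagonal, ← Matrix.diagonal_smul, ← Matrix.diagonal_smul,
    Matrix.diagonal_add]
  congr 1
  ext p
  simp only [Pi.smul_apply, smul_eq_mul]
  push_cast
  ring

theorem isSeparableMatrix_diagonal {k m : ℕ} {d : Fin k × Fin m → ℝ} (hd : ∀ p, 0 ≤ d p) :
    IsSeparableMatrix (Matrix.diagonal fun p => (d p : ℂ)) := by
  refine .of_fintype (fun i => Matrix.diagonal (Pi.single i 1))
    (fun i => Matrix.diagonal fun j => (d (i, j) : ℂ)) (fun i => ?_) (fun i => ?_) ?_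
  · rw [Matrix.posSemidef_diagonal_iff]
    intro j
    by_cases h : j = i <;> simp [h]
  · rw [Matrix.posSemidef_diagonal_iff]
    intro j
    exact_mod_cast hd (i, j)
  · ext p q
    simp only [Matrix.diagonal_kronecker_diagonal, Matrix.sum_apply, Matrix.diagonal_apply]
    split_ifs with h
    · simp [Pi.single_apply]
    · simp

theorem IsSeparableMatrix.posSemidef {k m : ℕ} {A : BipartiteMatrix k m}
    (hA : IsSeparableMatrix A) : A.PosSemidef := by
  obtain ⟨n, C, D, hC, hD, rfl⟩ := hA
  exact Matrix.posSemidef_sum _ fun i _ => (hC i).kronecker (hD i)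

theorem isSeparableMatrix_diagFamily_iff (hn : 1 ≤ n) {lam₁ lam₂ : ℝ}
    (h₂ : 0 < lam₂) : IsSeparableMatrix (diagFamily n lam₁ lam₂) ↔
      (n : ℝ) ^ 2 / ((n : ℝ) ^ 2 + n) ≤ lam₁ * (1 / ((n : ℝ) + 1)) / lam₂ := by
  have hn' : (1 : ℝ) ≤ n := by exact_mod_cast hn
  rw [diagFamily_eq_diagonal, le_div_iff₀ h₂]
  constructor
  · intro h
    -- The index `(0, 0)` carries the smallest diagonal entry, so it alone decides positivity.
    have h0 := (Matrix.posSemidef_diagonal_iff.mp h.posSemidef) (0, 0)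
    have h1 : 0 ≤ lam₁ * (1 / ((n : ℝ) + 1)) - lam₂ * (tracelessVec n 0 * tracelessVec n 0 /
      ((n : ℝ) ^ 2 + n)) := by exact_mod_cast h0
    simp only [tracelessVec, if_true, ← sq] at h1
    linarith
  · intro h
    refine isSeparableMatrix_diagonal fun p => ?_
    have hv : tracelessVec n p.1 * tracelessVec n p.2 ≤ (n : ℝ) ^ 2 := by
      unfold tracelessVec
      split_ifs <;> nlinarith
    have := mul_le_mul_of_nonneg_left
      (div_le_div_of_nonneg_right hv (by positivity : (0 : ℝ) ≤ (n : ℝ) ^ 2 + n)) h₂.le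
    linarith

theorem exists_lt_sq_div (l : ℝ) (hl : l < 1) :
    ∃ n : ℕ, 1 ≤ n ∧ l < (n : ℝ) ^ 2 / ((n : ℝ) ^ 2 + n) := by
  obtain ⟨n, hn⟩ := exists_nat_gt (1 / (1 - l))
  have h1 : 0 < 1 - l := by linarith
  have h0 : (0 : ℝ) < n := lt_trans (by positivity) hn
  refine ⟨n, by exact_mod_cast h0, ?_⟩
  rw [div_lt_iff₀ h1] at hn
  rw [lt_div_iff₀ (by positivity)]
  nlinarith

end DiagonalFamily

/-! ### A necessary condition for separability. -/

section EntangledCriterion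

variable {k m : ℕ}

theorem IsSeparableMatrix.exists_vectors {A : BipartiteMatrix k m} (hA : IsSeparableMatrix A) :
    ∃ (N : ℕ) (x : Fin N → Fin k → ℂ) (y : Fin N → Fin m → ℂ), ∀ p q,
      A p q = ∑ t, x t p.1 * star (x t q.1) * (y t p.2 * star (y t q.2)) := by
  obtain ⟨n, C, D, hC, hD, rfl⟩ := hA
  choose a u hu using fun i => Matrix.posSemidef_iff_eq_sum_vecMulVec.mp (hC i)
  choose b v hv using fun i => Matrix.posSemidef_iff_eq_sum_vecMulVec.mp (hD i)
  let e := Fintype.equivFin (Σ i, Fin (a i) × Fin (b i))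
  refine ⟨_, fun t => u (e.symm t).1 (e.symm t).2.1, fun t => v (e.symm t).1 (e.symm t).2.2, ?_⟩
  intro p q
  rw [Equiv.sum_comp e.symm fun s => u s.1 s.2.1 p.1 * star (u s.1 s.2.1 q.1) *
    (v s.1 s.2.2 p.2 * star (v s.1 s.2.2 q.2)), Fintype.sum_sigma, Matrix.sum_apply]
  refine Finset.sum_congr rfl fun i _ => ?_
  rw [Matrix.kroneckerMap_apply, hu i, hv i, Matrix.sum_apply, Matrix.sum_apply,
    Finset.sum_mul_sum, Fintype.sum_prod_type]
  rfl

/-- A range criterion: vectors in the kernels of `A` and of its partial transpose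
force `|xⱼ yⱼ| = |xₗ yₗ|` for the product vectors `x ⊗ y` of a separable decomposition. -/
theorem IsSeparableMatrix.two_le_re {n : ℕ} {A : BipartiteMatrix n n} (hA : IsSeparableMatrix A)
    {i j l : Fin n} {r : ℝ} (hr : 0 < r)
    (h₀ : A (i, i) (i, i) = (r : ℂ) ^ 2)
    (h₁ : A (j, j) (j, j) = 1) (h₂ : A (l, l) (l, l) = 1)
    (h₃ : A (i, i) (j, j) = r) (h₄ : A (j, j) (i, i) = r)
    (h₅ : A (l, i) (i, l) = r) (h₆ : A (i, l) (l, i) = r) :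
    2 ≤ (A (j, l) (j, l)).re + (A (l, j) (l, j)).re := by
  obtain ⟨N, x, y, h⟩ := hA.exists_vectors
  -- The sum of squared moduli is the quadratic form of `A` at a vector supported on `(i, i)` and
  -- `(j, j)`, and equals `r² - r² - r² + r² = 0`.
  have k₁ : ∀ t, x t i * y t i = r * (x t j * y t j) := by
    have hs : ∑ t, Complex.normSq (x t i * y t i - r * (x t j * y t j)) = 0 := by
      have : ((∑ t, Complex.normSq (x t i * y t i - r * (x t j * y t j)) : ℝ) : ℂ) =
          A (i, i) (i, i) - r * A (i, i) (j, j) - r * A (j, j) (i, i) +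
            r ^ 2 * A (j, j) (j, j) := by
        simp only [h, Finset.mul_sum, ← Finset.sum_sub_distrib, ← Finset.sum_add_distrib]
        push_cast
        refine Finset.sum_congr rfl fun t _ => ?_
        simp only [← Complex.mul_conj, map_sub, map_mul, Complex.conj_ofReal, Complex.star_def]
        ring
      rw [h₀, h₁, h₃, h₄] at this
      have h' : ((∑ t, Complex.normSq (x t i * y t i - r * (x t j * y t j)) : ℝ) : ℂ) = 0 := by
        rw [this]; ring
      exact_mod_cast h'
    intro t
    have := (Finset.sum_eq_zero_iff_of_nonneg fun t _ => Complex.normSq_nonneg _).mp hs t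
      (Finset.mem_univ t)
    exact sub_eq_zero.mp (Complex.normSq_eq_zero.mp this)
  -- Conjugating `x` repeats the argument for the partial transpose, with `l` in place of `j`.
  have k₂ : ∀ t, star (x t i) * y t i = r * (star (x t l) * y t l) := by
    have hs : ∑ t, Complex.normSq (star (x t i) * y t i - r * (star (x t l) * y t l)) = 0 := by
      have : ((∑ t, Complex.normSq (star (x t i) * y t i - r * (star (x t l) * y t l)) : ℝ) : ℂ) =
          A (i, i) (i, i) - r * A (l, i) (i, l) - r * A (i, l) (l, i) +
            r ^ 2 * A (l, l) (l, l) := by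
        simp only [h, Finset.mul_sum, ← Finset.sum_sub_distrib, ← Finset.sum_add_distrib]
        push_cast
        refine Finset.sum_congr rfl fun t _ => ?_
        simp only [← Complex.mul_conj, map_sub, map_mul, Complex.conj_ofReal, Complex.star_def,
          Complex.conj_conj]
        ring
      rw [h₀, h₂, h₅, h₆] at this
      have h' : ((∑ t, Complex.normSq (star (x t i) * y t i - r * (star (x t l) * y t l)) : ℝ) : ℂ)
          = 0 := by
        rw [this]; ring
      exact_mod_cast h'
    intro t
    have := (Finset.sum_eq_zero_iff_of_nonneg fun t _ => Complex.normSq_nonneg _).mp hs t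
      (Finset.mem_univ t)
    exact sub_eq_zero.mp (Complex.normSq_eq_zero.mp this)
  have hd (a b : Fin n) : (A (a, b) (a, b)).re = ∑ t, ‖x t a‖ ^ 2 * ‖y t b‖ ^ 2 := by
    rw [h, Complex.re_sum]
    refine Finset.sum_congr rfl fun t _ => ?_
    simp only [Complex.star_def, Complex.mul_conj', ← Complex.ofReal_pow, ← Complex.ofReal_mul,
      Complex.ofReal_re]
  have hj := hd j j
  rw [h₁, Complex.one_re] at hj
  rw [hd, hd, ← mul_one 2, hj, Finset.mul_sum, ← Finset.sum_add_distrib]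
  refine Finset.sum_le_sum fun t _ => ?_
  have n₁ := congrArg norm (k₁ t)
  have n₂ := congrArg norm (k₂ t)
  simp only [norm_mul, norm_star, Complex.norm_real, Real.norm_eq_abs, abs_of_pos hr] at n₁ n₂
  have hjl : ‖x t j‖ * ‖y t j‖ = ‖x t l‖ * ‖y t l‖ :=
    mul_left_cancel₀ hr.ne' (n₁.symm.trans n₂)
  have he : 2 * (‖x t j‖ ^ 2 * ‖y t j‖ ^ 2) =
      2 * (‖x t j‖ * ‖y t j‖) * (‖x t l‖ * ‖y t l‖) := by
    rw [← hjl]; ring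
  rw [he]
  -- Arithmetic–geometric mean inequality for `‖xⱼ‖ ‖yₗ‖` and `‖xₗ‖ ‖yⱼ‖`, whose product is `‖xⱼ yⱼ‖
  -- ‖xₗ yₗ‖`.
  nlinarith [sq_nonneg (‖x t j‖ * ‖y t l‖ - ‖x t l‖ * ‖y t j‖)]

end EntangledCriterion

/-! ### Positivity of coupled diagonal matrices and a kernel test for weak irreducibility. -/

section KernelStructure

/-- The matrix is a nonnegative diagonal `f` plus the rank one matrix of `r eₚ + e_q` and `r` times
that of `eₚ' + e_q'`; the hypotheses on `d` pay for their diagonals. -/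
theorem Matrix.posSemidef_diagonal_add_two_couplings {ι : Type*} [Fintype ι] [DecidableEq ι]
    {d : ι → ℝ} {r : ℝ} {p q p' q' : ι} (hr : 0 ≤ r) (hpq : p ≠ q) (hpp : p ≠ p') (hpq' : p ≠ q')
    (hqp : q ≠ p') (hqq : q ≠ q') (hpq'' : p' ≠ q') (hd : ∀ i, 0 ≤ d i)
    (hp : r ^ 2 ≤ d p) (hq : 1 ≤ d q) (hp' : r ≤ d p') (hq' : r ≤ d q') :
    (Matrix.diagonal (fun i => (d i : ℂ)) +
      (r : ℂ) • (Matrix.single p q (1 : ℂ) + Matrix.single q p 1) +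
      (r : ℂ) • (Matrix.single p' q' (1 : ℂ) + Matrix.single q' p' 1)).PosSemidef := by
  let f : ι → ℝ :=
    d - Pi.single p (r ^ 2) - Pi.single q 1 - Pi.single p' r - Pi.single q' r
  have hf (i : ι) : 0 ≤ f i := by
    by_cases e1 : i = p
    · subst e1; simp [f, hpq, hpp, hpq', hp]
    by_cases e2 : i = q
    · subst e2; simp [f, e1, hqp, hqq, hq]
    by_cases e3 : i = p'
    · subst e3; simp [f, e1, e2, hpq'', hp']
    by_cases e4 : i = q'
    · subst e4; simp [f, e1, e2, e3, hq']
    simp [f, e1, e2, e3, e4, hd]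
  have h1 := Matrix.PosSemidef.diagonal (n := ι) (d := fun i => (f i : ℂ))
    (fun i => Complex.zero_le_real.mpr (hf i))
  have h2 := Matrix.posSemidef_vecMulVec_self_star
    ((r : ℂ) • (Pi.single p 1 : ι → ℂ) + Pi.single q 1)
  have h3 := (Matrix.posSemidef_vecMulVec_self_star
    ((Pi.single p' 1 : ι → ℂ) + Pi.single q' 1)).smul (by exact_mod_cast hr : (0 : ℂ) ≤ r)
  convert (h1.add h2).add h3 using 1
  have hst (i : ι) : star (Pi.single i 1 : ι → ℂ) = Pi.single i 1 := by
    ext j; by_cases h : j = i <;> simp [h]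
  have hdg : Matrix.diagonal (fun i => (d i : ℂ)) = Matrix.diagonal (fun i => (f i : ℂ)) +
      ((r : ℂ) ^ 2 • Matrix.single p p 1 + Matrix.single q q 1 + (r : ℂ) • Matrix.single p' p' 1 +
        (r : ℂ) • Matrix.single q' q' 1) := by
    simp only [← Matrix.diagonal_single, ← Matrix.diagonal_smul, Matrix.diagonal_add]
    congr 1
    ext i
    simp only [f, Pi.sub_apply, Pi.smul_apply, smul_eq_mul, Pi.single_apply]
    push_cast
    split_ifs <;> simp
  rw [hdg]
  simp only [star_add, star_smul, hst, Matrix.vecMulVec_add, Matrix.add_vecMulVec,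
    Matrix.smul_vecMulVec, Matrix.vecMulVec_smul, ← Matrix.single_eq_single_vecMulVec_single]
  simp only [Complex.star_def, Complex.conj_ofReal]
  module

theorem partialTranspose_add {k m : ℕ} (A B : BipartiteMatrix k m) :
    partialTranspose (A + B) = partialTranspose A + partialTranspose B := rfl

theorem partialTranspose_smul {k m : ℕ} (c : ℂ) (A : BipartiteMatrix k m) :
    partialTranspose (c • A) = c • partialTranspose A := rfl

theorem partialTranspose_single {k m : ℕ} (a c : Fin k) (b e : Fin m) :
    partialTranspose (Matrix.single (a, b) (c, e) (1 : ℂ)) = Matrix.single (c, b) (a, e) 1 := by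
  have h := partialTranspose_kronecker (Matrix.single a c (1 : ℂ)) (Matrix.single b e (1 : ℂ))
  simpa [Matrix.single_kronecker_single] using h

theorem partialTranspose_diagonal {k m : ℕ} (d : Fin k × Fin m → ℂ) :
    partialTranspose (Matrix.diagonal d) = Matrix.diagonal d := by
  ext ⟨a, b⟩ ⟨c, e⟩
  by_cases h : a = c
  · subst h; simp [partialTranspose]
  · simp [partialTranspose, Matrix.diagonal_apply, h, Ne.symm h]

/-- A splitting gives `A * (V₁ ⊗ W₂) = 0`. The columns of `V₁ ⊗ W₂` are then product vectors in the
kernel, so `V₁ = 0` or `W₂ = 0`, and the corresponding block vanishes. -/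
theorem isWeakIrreducible_of_no_product_kernel {k m : ℕ} {A : BipartiteMatrix k m}
    (hA : A.PosSemidef)
    (h : ∀ (x : Fin k → ℂ) (y : Fin m → ℂ), A.mulVec (fun p => x p.1 * y p.2) = 0 →
      x = 0 ∨ y = 0) : IsWeakIrreducible A := by
  have key (V : Matrix (Fin k) (Fin k) ℂ) (W : Matrix (Fin m) (Fin m) ℂ)
      (h0 : A * (V ⊗ₖ W) = 0) : V = 0 ∨ W = 0 := by
    by_contra! hne
    obtain ⟨i, a, hV⟩ : ∃ i a, V i a ≠ 0 := by
      by_contra! hc; exact hne.1 (by ext i a; exact hc i a)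
    obtain ⟨j, b, hW⟩ : ∃ i a, W i a ≠ 0 := by
      by_contra! hc; exact hne.2 (by ext i a; exact hc i a)
    rcases h (fun i => V i a) (fun j => W j b) (by
      ext p
      exact congrFun (congrFun h0 p) (a, b)) with hx | hy
    · exact hV (congrFun hx i)
    · exact hW (congrFun hy j)
  refine ⟨hA, fun V₁ V₂ W₁ W₂ hV₁ hV₂ _ _ hV hW _ _ hs => ?_⟩
  have hV' : V₂ * V₁ = 0 := by
    have := congrArg Matrix.conjTranspose hV
    rwa [Matrix.conjTranspose_mul, hV₁.1.eq, hV₂.1.eq, Matrix.conjTranspose_zero] at this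
  have h0 : A * (V₁ ⊗ₖ W₂) = 0 := by
    rw [hs, Matrix.add_mul, Matrix.mul_assoc _ (V₁ ⊗ₖ W₁), Matrix.mul_assoc _ (V₂ ⊗ₖ W₂),
      ← Matrix.mul_kronecker_mul, ← Matrix.mul_kronecker_mul, hW, hV']
    simp
  rcases key _ _ h0 with h0 | h0
  · left; simp [h0]
  · right; simp [h0]

end KernelStructure

/-! ### An entangled weak irreducible PPT matrix. -/

section EntangledExample

variable {n : ℕ}

/-- The diagonal of `single e₁ e₁ 1 - single e₂ e₂ 1`. -/
def differenceVec (e₁ e₂ i : Fin (n + 1)) : ℝ := if i = e₁ then 1 else if i = e₂ then -1 else 0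

/-- The diagonal of `entangledMatrix`. -/
def entangledDiag (e₁ e₂ : Fin (n + 1)) (d : ℝ) (p : Fin (n + 1) × Fin (n + 1)) : ℝ :=
  1 - d * (tracelessVec n p.1 * tracelessVec n p.2) +
    d * (differenceVec e₁ e₂ p.1 * differenceVec e₁ e₂ p.2)

/-- A perturbation of `1 - single 0 0 1 ⊗ₖ single 0 0 1`, which is an entangled PPT matrix for
suitable values of `d` and `r`. -/
noncomputable def entangledMatrix (e₁ e₂ : Fin (n + 1)) (d r : ℝ) :
    BipartiteMatrix (n + 1) (n + 1) :=
  Matrix.diagonal (fun p => (entangledDiag e₁ e₂ d p : ℂ)) +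
    (r : ℂ) • (Matrix.single (0, 0) (e₁, e₁) 1 + Matrix.single (e₁, e₁) (0, 0) 1) +
    (r : ℂ) • (Matrix.single (e₂, 0) (0, e₂) 1 + Matrix.single (0, e₂) (e₂, 0) 1)

variable {e₁ e₂ : Fin (n + 1)} {d r : ℝ}

/-- Off `(0, 0)` each entry is at least `1 - 2 d`, and `d ≤ 1 / 4` because `d * n ^ 2 ≤ 1` with `n ≥
2`. -/
theorem entangledDiag_pos (hd0 : 0 < d) (hd : d * n ^ 2 = 1 - r ^ 2)
    (hn : 2 ≤ n) {p : Fin (n + 1) × Fin (n + 1)} (hp : p ≠ (0, 0)) :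
    0 < entangledDiag e₁ e₂ d p := by
  have hn' : (2 : ℝ) ≤ n := by exact_mod_cast hn
  have h4 : d * 4 ≤ d * n ^ 2 := mul_le_mul_of_nonneg_left (by nlinarith) hd0.le
  have hz : -1 ≤ differenceVec e₁ e₂ p.1 * differenceVec e₁ e₂ p.2 := by
    unfold differenceVec
    split_ifs <;> norm_num
  have ht : tracelessVec n p.1 * tracelessVec n p.2 ≤ 1 := by
    unfold tracelessVec
    split_ifs with ha hb <;> first | exact (hp (Prod.ext ha hb)).elim | linarith
  unfold entangledDiag
  linarith [mul_le_mul_of_nonneg_left hz hd0.le, mul_le_mul_of_nonneg_left ht hd0.le,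
    sq_nonneg r]

theorem entangledDiag_zero_zero (h₁ : e₁ ≠ 0) (h₂ : e₂ ≠ 0) (hd : d * n ^ 2 = 1 - r ^ 2) :
    entangledDiag e₁ e₂ d (0, 0) = r ^ 2 := by
  simp only [entangledDiag, tracelessVec, differenceVec, h₁.symm, h₂.symm, if_true, if_false]
  linarith

theorem entangledDiag_left (h₁ : e₁ ≠ 0) : entangledDiag e₁ e₂ d (e₁, e₁) = 1 := by
  simp [entangledDiag, tracelessVec, differenceVec, h₁]

theorem entangledDiag_right (h₂ : e₂ ≠ 0) (h₁₂ : e₁ ≠ e₂) :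
    entangledDiag e₁ e₂ d (e₂, e₂) = 1 := by
  simp [entangledDiag, tracelessVec, differenceVec, h₂, h₁₂.symm]

theorem entangledDiag_fst_zero (h₁ : e₁ ≠ 0) (h₂ : e₂ ≠ 0) {i : Fin (n + 1)} (hi : i ≠ 0) :
    entangledDiag e₁ e₂ d (i, 0) = 1 + d * n := by
  simp [entangledDiag, tracelessVec, differenceVec, h₁.symm, h₂.symm, hi]

theorem entangledDiag_zero_snd (h₁ : e₁ ≠ 0) (h₂ : e₂ ≠ 0) {i : Fin (n + 1)} (hi : i ≠ 0) :
    entangledDiag e₁ e₂ d (0, i) = 1 + d * n := by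
  simp [entangledDiag, tracelessVec, differenceVec, h₁.symm, h₂.symm, hi]

theorem isPPT_entangledMatrix (h₁ : e₁ ≠ 0) (h₂ : e₂ ≠ 0) (h₁₂ : e₁ ≠ e₂) (hn : 2 ≤ n)
    (hr : 0 < r) (hr1 : r < 1) (hd0 : 0 < d) (hd : d * n ^ 2 = 1 - r ^ 2) :
    IsPPT (entangledMatrix e₁ e₂ d r) := by
  have e00 := entangledDiag_zero_zero h₁ h₂ hd
  have ei0 (i : Fin (n + 1)) (hi : i ≠ 0) := entangledDiag_fst_zero (d := d) h₁ h₂ hi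
  have e0i (i : Fin (n + 1)) (hi : i ≠ 0) := entangledDiag_zero_snd (d := d) h₁ h₂ hi
  have hdn : 0 ≤ d * n := by positivity
  have hnn (p : Fin (n + 1) × Fin (n + 1)) : 0 ≤ entangledDiag e₁ e₂ d p := by
    by_cases hp : p = (0, 0)
    · rw [hp, e00]
      positivity
    · exact (entangledDiag_pos hd0 hd hn hp).le
  constructor
  · apply Matrix.posSemidef_diagonal_add_two_couplings <;>
      simp only [ne_eq, Prod.mk.injEq, e00, entangledDiag_left h₁, ei0 e₂ h₂, e0i e₂ h₂, h₁, h₂, h₁.symm, h₂.symm,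
        h₁₂, false_and, and_false, not_false_eq_true, le_refl, hr.le, hnn,
        implies_true] <;> linarith
  -- Partial transposition exchanges the roles of `e₁` and `e₂`.
  · have : partialTranspose (entangledMatrix e₁ e₂ d r) =
        Matrix.diagonal (fun p => (entangledDiag e₁ e₂ d p : ℂ)) +
        (r : ℂ) • (Matrix.single (0, 0) (e₂, e₂) 1 + Matrix.single (e₂, e₂) (0, 0) 1) +
        (r : ℂ) • (Matrix.single (e₁, 0) (0, e₁) 1 + Matrix.single (0, e₁) (e₁, 0) 1) := by
      simp only [entangledMatrix, partialTranspose_add, partialTranspose_smul,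
        partialTranspose_single, partialTranspose_diagonal]
      abel
    rw [this]
    apply Matrix.posSemidef_diagonal_add_two_couplings <;>
      simp only [ne_eq, Prod.mk.injEq, e00, entangledDiag_right h₂ h₁₂, ei0 e₁ h₁, e0i e₁ h₁, h₁, h₂, h₁.symm, h₂.symm,
        h₁₂.symm, false_and, and_false, not_false_eq_true, le_refl, hr.le, hnn,
        implies_true] <;> linarith

/-- The diagonal entries at `(e₁, e₂)` and `(e₂, e₁)` are both `1 - 2 d`, so their sum is below the
bound `2` of the range criterion. The `differenceVec` term serves to lower these two while raising
`(e₁, e₁)` and `(e₂, e₂)` back to `1`. -/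
theorem not_isSeparableMatrix_entangledMatrix (h₁ : e₁ ≠ 0) (h₂ : e₂ ≠ 0) (h₁₂ : e₁ ≠ e₂)
    (hr : 0 < r) (hd0 : 0 < d) (hd : d * n ^ 2 = 1 - r ^ 2) :
    ¬ IsSeparableMatrix (entangledMatrix e₁ e₂ d r) := by
  intro h
  have hd' : (d : ℂ) * n ^ 2 = 1 - r ^ 2 := by exact_mod_cast congrArg Complex.ofReal hd
  have := h.two_le_re (i := 0) (j := e₁) (l := e₂) hr ?_ ?_ ?_ ?_ ?_ ?_ ?_
  · simp [entangledMatrix, entangledDiag, tracelessVec, differenceVec, h₁, h₂,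
      h₁.symm, h₂.symm, h₁₂, h₁₂.symm] at this
    linarith
  all_goals
    simp [entangledMatrix, entangledDiag, tracelessVec, differenceVec, h₁, h₂, h₁.symm, h₂.symm, h₁₂, h₁₂.symm]
  linear_combination -hd'

theorem isWeakIrreducible_entangledMatrix (h₁ : e₁ ≠ 0) (h₂ : e₂ ≠ 0) (h₁₂ : e₁ ≠ e₂) (hn : 2 ≤ n)
    (hr : 0 < r) (hr1 : r < 1) (hd0 : 0 < d) (hd : d * n ^ 2 = 1 - r ^ 2) :
    IsWeakIrreducible (entangledMatrix e₁ e₂ d r) := by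
  refine isWeakIrreducible_of_no_product_kernel
    (isPPT_entangledMatrix h₁ h₂ h₁₂ hn hr hr1 hd0 hd).1 fun x y hxy => ?_
  have hc (p : Fin (n + 1) × Fin (n + 1)) := congrFun hxy p
  have hv (p q s : Fin (n + 1) × Fin (n + 1)) (v : Fin (n + 1) × Fin (n + 1) → ℂ) :
      (Matrix.single p q (1 : ℂ)).mulVec v s = if s = p then v q else 0 := by
    rw [Matrix.single_mulVec, one_mul, Function.update_apply]; rfl
  simp only [entangledMatrix, Matrix.add_mulVec, Matrix.smul_mulVec, Pi.add_apply, Pi.smul_apply,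
    Matrix.mulVec_diagonal, hv, smul_eq_mul, Pi.zero_apply] at hc
  have c₁ := hc (e₁, e₁)
  have c₂ := hc (e₂, 0)
  have c₃ := hc (0, e₂)
  rw [entangledDiag_left h₁] at c₁
  rw [entangledDiag_fst_zero h₁ h₂ h₂] at c₂
  rw [entangledDiag_zero_snd h₁ h₂ h₂] at c₃
  simp only [Prod.mk.injEq, h₁, h₂, h₁.symm, h₂.symm, h₁₂, and_self, if_true, if_false,
    and_false, false_and, add_zero, zero_add, mul_zero, Complex.ofReal_one, one_mul] at c₁ c₂ c₃
  -- This is the determinant of the block on `(e₂, 0)` and `(0, e₂)`.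
  have hD : ((1 + d * n : ℝ) : ℂ) ^ 2 - (r : ℂ) ^ 2 ≠ 0 := by
    have : 0 ≤ d * n := by positivity
    have : (1 + d * n) ^ 2 - r ^ 2 ≠ 0 := by nlinarith
    exact_mod_cast this
  have z₂ : x e₂ * y 0 = 0 := by
    refine (mul_eq_zero.mp ?_).resolve_left hD
    linear_combination ((1 + d * n : ℝ) : ℂ) * c₂ - r * c₃
  have z₃ : x 0 * y e₂ = 0 := by
    refine (mul_eq_zero.mp ?_).resolve_left hD
    linear_combination ((1 + d * n : ℝ) : ℂ) * c₃ - r * c₂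
  have z (i j : Fin (n + 1)) (h00 : ¬(i = 0 ∧ j = 0)) (h11 : ¬(i = e₁ ∧ j = e₁)) :
      x i * y j = 0 := by
    by_cases h20 : i = e₂ ∧ j = 0
    · rw [h20.1, h20.2, z₂]
    by_cases h02 : i = 0 ∧ j = e₂
    · rw [h02.1, h02.2, z₃]
    have c := hc (i, j)
    simp only [Prod.mk.injEq, h00, h11, h20, h02, if_false, add_zero, mul_zero] at c
    refine (mul_eq_zero.mp c).resolve_left ?_
    exact_mod_cast (entangledDiag_pos hd0 hd hn (p := (i, j)) (by simpa using h00)).ne'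
  have hr' : (r : ℂ) ≠ 0 := by exact_mod_cast hr.ne'
  have z₀ : x 0 * y 0 = 0 := by
    have h01 := z 0 e₁ (by simp [h₁]) (by simp [h₁.symm])
    -- For a product vector, the entries at `(0, 0)` and `(e₁, e₁)` multiply to those at `(e₁, 0)`
    -- and `(0, e₁)`, which vanish. So the one-dimensional kernel of the `(0, 0)`, `(e₁, e₁)` block
    -- contributes no product vector.
    have : (r : ℂ) * (x 0 * y 0) ^ 2 = 0 := by
      linear_combination (x 0 * y 0) * c₁ - (x e₁ * y 0) * h01
    simpa [hr'] using this
  have z₁ : x e₁ * y e₁ = 0 := by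
    rw [z₀, mul_zero, add_zero] at c₁
    exact c₁
  by_contra! hne
  obtain ⟨i, hi⟩ := Function.ne_iff.mp hne.1
  obtain ⟨j, hj⟩ := Function.ne_iff.mp hne.2
  refine mul_ne_zero hi hj ?_
  by_cases h00 : i = 0 ∧ j = 0
  · rw [h00.1, h00.2, z₀]
  by_cases h11 : i = e₁ ∧ j = e₁
  · rw [h11.1, h11.2, z₁]
  exact z i j h00 h11

end EntangledExample

/-! ### Normalized Hermitian matrix units. -/

section HermitianBasis

variable {k : ℕ}

/-- The complex number `1 / √2`. -/
noncomputable def invSqrtTwo : ℂ := ((1 / Real.sqrt 2 : ℝ) : ℂ)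

theorem invSqrtTwo_mul_self : invSqrtTwo * invSqrtTwo = 1 / 2 := by
  have : (1 / Real.sqrt 2) * (1 / Real.sqrt 2) = 1 / 2 := by
    rw [div_mul_div_comm, Real.mul_self_sqrt (by norm_num), one_mul]
  rw [invSqrtTwo, ← Complex.ofReal_mul, this]
  push_cast
  rfl

theorem conj_invSqrtTwo : (starRingEnd ℂ) invSqrtTwo = invSqrtTwo := Complex.conj_ofReal _

/-- `(Eₚₚ - E_qq) / √2`. -/
noncomputable def diffBasis (p q : Fin k) : Matrix (Fin k) (Fin k) ℂ :=
  invSqrtTwo • (Matrix.single p p 1 - Matrix.single q q 1)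

/-- `(E_pq + E_qp) / √2`. -/
noncomputable def symmBasis (p q : Fin k) : Matrix (Fin k) (Fin k) ℂ :=
  invSqrtTwo • (Matrix.single p q 1 + Matrix.single q p 1)

/-- `i (E_qp - E_pq) / √2`. -/
noncomputable def skewBasis (p q : Fin k) : Matrix (Fin k) (Fin k) ℂ :=
  (invSqrtTwo * Complex.I) • (Matrix.single q p 1 - Matrix.single p q 1)

theorem isHermitian_diffBasis (p q : Fin k) : (diffBasis p q).IsHermitian := by
  simp only [Matrix.IsHermitian, diffBasis, Matrix.conjTranspose_smul, Matrix.conjTranspose_sub,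
    Matrix.conjTranspose_single, Complex.star_def, conj_invSqrtTwo, map_one]

theorem isHermitian_symmBasis (p q : Fin k) : (symmBasis p q).IsHermitian := by
  simp only [Matrix.IsHermitian, symmBasis, Matrix.conjTranspose_smul, Matrix.conjTranspose_add,
    Matrix.conjTranspose_single, Complex.star_def, conj_invSqrtTwo, map_one]
  rw [add_comm]

theorem isHermitian_skewBasis (p q : Fin k) : (skewBasis p q).IsHermitian := by
  simp only [Matrix.IsHermitian, skewBasis, Matrix.conjTranspose_smul, Matrix.conjTranspose_sub,
    Matrix.conjTranspose_single, Complex.star_def, conj_invSqrtTwo, map_one, map_mul,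
    Complex.conj_I]
  module

theorem trace_mul_diffBasis (M : Matrix (Fin k) (Fin k) ℂ) (p q : Fin k) :
    (M * diffBasis p q).trace = invSqrtTwo * (M p p - M q q) := by
  simp only [diffBasis, Matrix.mul_smul, Matrix.mul_sub, Matrix.trace_smul, Matrix.trace_sub,
    Matrix.trace_mul_single, smul_eq_mul, MulOpposite.op_one, one_smul]

theorem trace_mul_symmBasis (M : Matrix (Fin k) (Fin k) ℂ) (p q : Fin k) :
    (M * symmBasis p q).trace = invSqrtTwo * (M q p + M p q) := by
  simp only [symmBasis, Matrix.mul_smul, Matrix.mul_add, Matrix.trace_smul, Matrix.trace_add,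
    Matrix.trace_mul_single, smul_eq_mul, MulOpposite.op_one, one_smul]

theorem trace_mul_skewBasis (M : Matrix (Fin k) (Fin k) ℂ) (p q : Fin k) :
    (M * skewBasis p q).trace =
      invSqrtTwo * Complex.I * (M p q - M q p) := by
  simp only [skewBasis, Matrix.mul_smul, Matrix.mul_sub, Matrix.trace_smul, Matrix.trace_sub,
    Matrix.trace_mul_single, smul_eq_mul, MulOpposite.op_one, one_smul]

theorem trace_diffBasis_mul_self {p q : Fin k} (h : p ≠ q) :
    (diffBasis p q * diffBasis p q).trace = 1 := by
  rw [trace_mul_diffBasis]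
  simp [diffBasis, h, h.symm]
  linear_combination 2 * invSqrtTwo_mul_self

theorem trace_symmBasis_mul_self {p q : Fin k} (h : p ≠ q) :
    (symmBasis p q * symmBasis p q).trace = 1 := by
  rw [trace_mul_symmBasis]
  simp [symmBasis, h, h.symm]
  linear_combination 2 * invSqrtTwo_mul_self

theorem trace_skewBasis_mul_self {p q : Fin k} (h : p ≠ q) :
    (skewBasis p q * skewBasis p q).trace = 1 := by
  rw [trace_mul_skewBasis]
  simp [skewBasis, h, h.symm]
  linear_combination (-2 * invSqrtTwo * invSqrtTwo) * Complex.I_mul_I + 2 * invSqrtTwo_mul_self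

/-- The symmetric term yields both kinds of coupling, `pp` with `qq` and `pq` with `qp`, each with
weight one half; the sign of the skew term decides which kind cancels and which doubles. -/
theorem symmBasis_kronecker_add_skewBasis_neg (p q : Fin k) :
    symmBasis p q ⊗ₖ symmBasis p q + skewBasis p q ⊗ₖ (-skewBasis p q) =
      Matrix.single (p, p) (q, q) 1 + Matrix.single (q, q) (p, p) 1 := by
  have e : (-skewBasis p q : Matrix (Fin k) (Fin k) ℂ) = (invSqrtTwo * Complex.I) •
      (Matrix.single p q 1 - Matrix.single q p 1) := by rw [skewBasis]; module
  rw [e]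
  rw [symmBasis, skewBasis, Matrix.smul_kronecker, Matrix.kronecker_smul, smul_smul,
    Matrix.smul_kronecker, Matrix.kronecker_smul, smul_smul, mul_mul_mul_comm,
    invSqrtTwo_mul_self, Complex.I_mul_I]
  simp only [Matrix.add_kronecker, Matrix.kronecker_add, Matrix.sub_kronecker,
    Matrix.kronecker_sub, Matrix.single_kronecker_single, mul_one]
  module

theorem symmBasis_kronecker_add_skewBasis (p q : Fin k) :
    symmBasis p q ⊗ₖ symmBasis p q + skewBasis p q ⊗ₖ skewBasis p q =
      Matrix.single (q, p) (p, q) 1 + Matrix.single (p, q) (q, p) 1 := by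
  rw [symmBasis, skewBasis, Matrix.smul_kronecker, Matrix.kronecker_smul, smul_smul,
    Matrix.smul_kronecker, Matrix.kronecker_smul, smul_smul, mul_mul_mul_comm,
    invSqrtTwo_mul_self, Complex.I_mul_I]
  simp only [Matrix.add_kronecker, Matrix.kronecker_add, Matrix.sub_kronecker,
    Matrix.kronecker_sub, Matrix.single_kronecker_single, mul_one]
  module

theorem diffBasis_kronecker_diffBasis {n : ℕ} {p q : Fin (n + 1)} (hpq : p ≠ q) :
    diffBasis p q ⊗ₖ diffBasis p q = Matrix.diagonal fun s =>
      ((differenceVec p q s.1 * differenceVec p q s.2 / 2 : ℝ) : ℂ) := by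
  have h : diffBasis p q = Matrix.diagonal fun i =>
      invSqrtTwo * (differenceVec p q i : ℂ) := by
    rw [diffBasis, ← Matrix.diagonal_single, ← Matrix.diagonal_single, Matrix.diagonal_sub,
      ← Matrix.diagonal_smul]
    congr 1
    ext i
    simp only [Pi.smul_apply, Pi.single_apply, differenceVec, smul_eq_mul]
    by_cases h1 : i = p
    · subst h1; simp [hpq]
    · by_cases h2 : i = q <;> simp [h1, h2, hpq.symm]
  rw [h, Matrix.diagonal_kronecker_diagonal]
  congr 1
  ext s
  rw [mul_mul_mul_comm, invSqrtTwo_mul_self]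
  push_cast
  ring

end HermitianBasis

theorem isOrthonormalFamily_of_lt {k n : ℕ} {γ : Fin n → Matrix (Fin k) (Fin k) ℂ}
    (hγ : ∀ i, (γ i).IsHermitian) (h1 : ∀ i, (γ i * γ i).trace = 1)
    (h0 : ∀ i j, i < j → (γ i * γ j).trace = 0) : IsOrthonormalFamily γ := by
  intro i j
  rw [(hγ j).eq]
  rcases lt_trichotomy i j with h | rfl | h
  · rw [h0 i j h, if_neg h.ne]
  · rw [h1, if_pos rfl]
  · rw [Matrix.trace_mul_comm, h0 j i h, if_neg h.ne']

theorem IsOrthonormalFamily.of_eq_or_eq_neg {k n : ℕ} {γ δ : Fin n → Matrix (Fin k) (Fin k) ℂ}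
    (hγ : IsOrthonormalFamily γ) (h : ∀ i, δ i = γ i ∨ δ i = -γ i) : IsOrthonormalFamily δ := by
  intro i j
  by_cases hij : i = j
  · subst hij
    rcases h i with hi | hi <;> simp [hi, hγ i i]
  · rcases h i with hi | hi <;> rcases h j with hj | hj <;> simp [hi, hj, hγ i j, hij]

/-! ### Schmidt decomposition of the entangled matrix. -/

section EntangledSchmidt

variable {n : ℕ} {e₁ e₂ : Fin (n + 1)} {d r : ℝ}

/-- The left Schmidt vectors of `entangledMatrix`. -/
noncomputable def entangledLeft (e₁ e₂ : Fin (n + 1)) :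
    Fin 7 → Matrix (Fin (n + 1)) (Fin (n + 1)) ℂ :=
  ![normalizedOne n, tracelessDiag n, diffBasis e₁ e₂, symmBasis 0 e₁, skewBasis 0 e₁,
    symmBasis 0 e₂, skewBasis 0 e₂]

/-- The right Schmidt vectors of `entangledMatrix`. -/
noncomputable def entangledRight (e₁ e₂ : Fin (n + 1)) :
    Fin 7 → Matrix (Fin (n + 1)) (Fin (n + 1)) ℂ :=
  ![normalizedOne n, -tracelessDiag n, diffBasis e₁ e₂, symmBasis 0 e₁, -skewBasis 0 e₁,
    symmBasis 0 e₂, skewBasis 0 e₂]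

/-- The Schmidt coefficients of `entangledMatrix`. -/
noncomputable def entangledCoeff (n : ℕ) (d r : ℝ) : Fin 7 → ℝ :=
  ![n + 1, d * (n ^ 2 + n), 2 * d, r, r, r, r]

theorem isHermitian_entangledLeft (i : Fin 7) : (entangledLeft e₁ e₂ i).IsHermitian := by
  fin_cases i
  exacts [isHermitian_normalizedOne n, isHermitian_tracelessDiag n, isHermitian_diffBasis _ _,
    isHermitian_symmBasis _ _, isHermitian_skewBasis _ _, isHermitian_symmBasis _ _,
    isHermitian_skewBasis _ _]

theorem entangledRight_eq_or_eq_neg (i : Fin 7) : entangledRight e₁ e₂ i = entangledLeft e₁ e₂ i ∨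
    entangledRight e₁ e₂ i = -entangledLeft e₁ e₂ i := by
  fin_cases i <;> simp [entangledRight, entangledLeft]

theorem isOrthonormalFamily_entangledLeft (h₁ : e₁ ≠ 0) (h₂ : e₂ ≠ 0) (h₁₂ : e₁ ≠ e₂)
    (hn : 1 ≤ n) : IsOrthonormalFamily (entangledLeft e₁ e₂) := by
  refine isOrthonormalFamily_of_lt isHermitian_entangledLeft (fun i => ?_) fun i j hij => ?_
  · fin_cases i
    exacts [trace_normalizedOne_mul_self n, trace_tracelessDiag_mul_self hn,
      trace_diffBasis_mul_self h₁₂, trace_symmBasis_mul_self h₁.symm,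
      trace_skewBasis_mul_self h₁.symm, trace_symmBasis_mul_self h₂.symm,
      trace_skewBasis_mul_self h₂.symm]
  -- Fixing the later vector first lets each trace formula read the product off two entries of the
  -- earlier vector.
  · fin_cases j
    · exact absurd hij (Fin.not_lt_zero i)
    · obtain rfl : i = 0 := Fin.lt_one_iff i |>.mp hij
      exact trace_normalizedOne_mul_tracelessDiag n
    · change (_ * diffBasis e₁ e₂).trace = 0
      rw [trace_mul_diffBasis]
      fin_cases i <;> first
        | exact absurd hij (by decide)
        | simp [entangledLeft, normalizedOne, tracelessDiag, h₁, h₂]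
    · change (_ * symmBasis 0 e₁).trace = 0
      rw [trace_mul_symmBasis]
      fin_cases i <;> first
        | exact absurd hij (by decide)
        | simp [entangledLeft, normalizedOne, tracelessDiag, diffBasis, h₁, h₂, h₁.symm]
    · change (_ * skewBasis 0 e₁).trace = 0
      rw [trace_mul_skewBasis]
      fin_cases i <;> first
        | exact absurd hij (by decide)
        | simp [entangledLeft, normalizedOne, tracelessDiag, diffBasis, symmBasis, h₁, h₂, h₁.symm]
    · change (_ * symmBasis 0 e₂).trace = 0
      rw [trace_mul_symmBasis]
      fin_cases i <;> first
        | exact absurd hij (by decide)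
        | simp [entangledLeft, normalizedOne, tracelessDiag, diffBasis, symmBasis, skewBasis, h₁,
            h₂, h₁₂, h₂.symm]
    · change (_ * skewBasis 0 e₂).trace = 0
      rw [trace_mul_skewBasis]
      fin_cases i <;> first
        | exact absurd hij (by decide)
        | simp [entangledLeft, normalizedOne, tracelessDiag, diffBasis, symmBasis, skewBasis, h₁,
            h₂, h₁₂, h₂.symm]

theorem isHermitianSchmidtDecomposition_entangledMatrix (h₁ : e₁ ≠ 0) (h₂ : e₂ ≠ 0)
    (h₁₂ : e₁ ≠ e₂) (hn : 1 ≤ n) (hr : 0 < r) (hd0 : 0 < d) :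
    IsHermitianSchmidtDecomposition (entangledMatrix e₁ e₂ d r) (entangledCoeff n d r)
      (entangledLeft e₁ e₂) (entangledRight e₁ e₂) where
  lam_pos i := by
    have hn' : (0 : ℝ) < n := by exact_mod_cast hn
    fin_cases i
    exacts [by change (0 : ℝ) < n + 1; positivity,
      by change 0 < d * ((n : ℝ) ^ 2 + n); positivity, by change 0 < 2 * d; positivity,
      hr, hr, hr, hr]
  hermitian_left := isHermitian_entangledLeft
  hermitian_right i := by
    rcases entangledRight_eq_or_eq_neg (e₁ := e₁) (e₂ := e₂) i with h | h <;> rw [h]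
    exacts [isHermitian_entangledLeft i, (isHermitian_entangledLeft i).neg]
  orthonormal_left := isOrthonormalFamily_entangledLeft h₁ h₂ h₁₂ hn
  orthonormal_right :=
    (isOrthonormalFamily_entangledLeft h₁ h₂ h₁₂ hn).of_eq_or_eq_neg entangledRight_eq_or_eq_neg
  eq_sum := by
    have hn' : (0 : ℝ) < n := by exact_mod_cast hn
    -- The coefficients `n + 1`, `d * (n ^ 2 + n)` and `2 * d` cancel the normalizations of the
    -- three diagonal Schmidt vectors.
    have hdiag : Matrix.diagonal (fun p => (entangledDiag e₁ e₂ d p : ℂ)) =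
        ((n + 1 : ℝ) : ℂ) • (normalizedOne n ⊗ₖ normalizedOne n) +
        ((d * ((n : ℝ) ^ 2 + n) : ℝ) : ℂ) • (tracelessDiag n ⊗ₖ (-tracelessDiag n)) +
        ((2 * d : ℝ) : ℂ) • (diffBasis e₁ e₂ ⊗ₖ diffBasis e₁ e₂) := by
      rw [normalizedOne_kronecker_normalizedOne, tracelessDiag_kronecker_neg,
        diffBasis_kronecker_diffBasis h₁₂, Matrix.smul_one_eq_diagonal, ← Matrix.diagonal_smul,
        ← Matrix.diagonal_smul, ← Matrix.diagonal_smul, Matrix.diagonal_add, Matrix.diagonal_add]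
      congr 1
      ext p
      simp only [Pi.smul_apply, smul_eq_mul, ← Complex.ofReal_mul, ← Complex.ofReal_add]
      congr 1
      rw [entangledDiag]
      field_simp
      ring
    rw [entangledMatrix, hdiag, ← symmBasis_kronecker_add_skewBasis_neg,
      ← symmBasis_kronecker_add_skewBasis]
    simp only [Fin.sum_univ_seven, entangledCoeff, entangledLeft, entangledRight]
    simp only [Matrix.cons_val, smul_add]
    abel

end EntangledSchmidt

/-! ### Optimality of the constant and the final assembly. -/

/-- Since division by zero gives `0 < l`, the ratio bound also encodes that the denominator is
nonzero. -/
theorem exists_entangled_of_lt_one {l : ℝ} (hl0 : 0 < l) (hl : l < 1) :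
    ∃ (k m n : ℕ) (A : BipartiteMatrix k m) (lam : Fin (n + 1) → ℝ)
      (γ : Fin (n + 1) → Matrix (Fin k) (Fin k) ℂ)
      (δ : Fin (n + 1) → Matrix (Fin m) (Fin m) ℂ) (μ : ℝ),
      IsWeakIrreducible A ∧ IsPPT A ∧
      IsHermitianSchmidtDecomposition A lam γ δ ∧ Antitone lam ∧
      IsLeastPositiveEigenvalue (γ 0 ⊗ₖ δ 0) μ ∧
      l ≤ lam 0 * μ / ∑ i : Fin n, lam i.succ ∧
      ¬ IsSeparableMatrix A := by
  obtain ⟨N, hN⟩ := exists_nat_gt (7 / (1 - l))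
  have hl1 : 0 < 1 - l := by linarith
  obtain ⟨n, hn2, hn⟩ : ∃ n : ℕ, 2 ≤ n ∧ 7 / (1 - l) ≤ n :=
    ⟨max N 2, le_max_right _ _, hN.le.trans (by exact_mod_cast le_max_left _ _)⟩
  have hn2' : (2 : ℝ) ≤ n := by exact_mod_cast hn2
  have hn0 : (0 : ℝ) < n := by linarith
  rw [div_le_iff₀ hl1] at hn
  -- The coupling is small enough that the coefficients other than `lam 0` sum to at most `1 + 7 /
  -- n`, while `lam 0 * μ = 1`. The value of `d` is forced by `d * n ^ 2 = 1 - r ^ 2`, which makes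
  -- the `(0, 0)` entry equal to `r ^ 2`.
  set r : ℝ := 1 / (n : ℝ) ^ 2 with hrdef
  have hnr : (n : ℝ) ^ 2 * r = 1 := by rw [hrdef]; field_simp
  have hr0 : 0 < r := by positivity
  have hr4 : r ≤ 1 / 4 := by nlinarith
  set d : ℝ := (1 - r ^ 2) * r with hddef
  have hd0 : 0 < d := by
    have : 0 < 1 - r ^ 2 := by nlinarith
    positivity
  have hd : d * n ^ 2 = 1 - r ^ 2 := by
    rw [hddef, mul_assoc, mul_comm r, hnr, mul_one]
  have hdr : d ≤ r := by nlinarith [sq_nonneg r]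
  have hrd : r ≤ 2 * d := by nlinarith [sq_nonneg r]
  let e₁ : Fin (n + 1) := ⟨1, by omega⟩
  let e₂ : Fin (n + 1) := ⟨2, by omega⟩
  have h₁ : e₁ ≠ 0 := by simp [e₁, Fin.ext_iff]
  have h₂ : e₂ ≠ 0 := by simp [e₂, Fin.ext_iff]
  have h₁₂ : e₁ ≠ e₂ := by simp [e₁, e₂, Fin.ext_iff]
  refine ⟨n + 1, n + 1, 6, entangledMatrix e₁ e₂ d r, entangledCoeff n d r, entangledLeft e₁ e₂,
    entangledRight e₁ e₂, 1 / ((n : ℝ) + 1),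
    isWeakIrreducible_entangledMatrix h₁ h₂ h₁₂ hn2 hr0 (by linarith) hd0 hd,
    isPPT_entangledMatrix h₁ h₂ h₁₂ hn2 hr0 (by linarith) hd0 hd,
    isHermitianSchmidtDecomposition_entangledMatrix h₁ h₂ h₁₂ (by omega) hr0 hd0, ?_,
    isLeastPositiveEigenvalue_normalizedOne n, ?_,
    not_isSeparableMatrix_entangledMatrix h₁ h₂ h₁₂ hr0 hd0 hd⟩
  · have hdn : d * n ≤ 1 := by nlinarith [sq_nonneg r]
    rw [Fin.antitone_iff_succ_le]
    intro i
    fin_cases i <;> simp [entangledCoeff] <;> nlinarith [sq_nonneg r]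
  · have hsum : ∑ i : Fin 6, entangledCoeff n d r i.succ = d * (n ^ 2 + n) + 2 * d + 4 * r := by
      simp [entangledCoeff, Fin.sum_univ_six]
      ring
    have h0 : entangledCoeff n d r 0 * (1 / ((n : ℝ) + 1)) = 1 := by
      simp only [entangledCoeff, Matrix.cons_val_zero]
      field_simp
    rw [hsum, h0, le_div_iff₀ (by positivity)]
    have hrn : r * n ≤ 1 / 2 := by nlinarith
    have hb : d * (n ^ 2 + n) + 2 * d + 4 * r ≤ 1 + 7 * (r * n) := by
      nlinarith [sq_nonneg r]
    have hb' : 7 * (r * n) ≤ 1 - l := by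
      have := mul_le_mul_of_nonneg_left hn (by positivity : 0 ≤ r * n)
      nlinarith
    -- It remains that `l * (1 + (1 - l)) = 1 - (1 - l) ^ 2 ≤ 1`.
    nlinarith

theorem mainTheorem7 :
    -- the inequality (the index `0` plays the role of the first, largest coefficient)
    (∀ (k m n : ℕ) (A : BipartiteMatrix k m) (lam : Fin (n + 1) → ℝ)
        (γ : Fin (n + 1) → Matrix (Fin k) (Fin k) ℂ)
        (δ : Fin (n + 1) → Matrix (Fin m) (Fin m) ℂ) (μ : ℝ),
        IsWeakIrreducible A → IsPPT A →
        IsHermitianSchmidtDecomposition A lam γ δ → Antitone lam →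
        IsLeastPositiveEigenvalue (γ 0 ⊗ₖ δ 0) μ →
        ∑ i : Fin n, lam i.succ ≤ lam 0 * μ →
        IsSeparableMatrix A) ∧
    -- the constant `1` cannot be replaced by a smaller one
    (∀ l : ℝ, 0 < l → l < 1 →
      ∃ (k m n : ℕ) (A : BipartiteMatrix k m) (lam : Fin (n + 1) → ℝ)
        (γ : Fin (n + 1) → Matrix (Fin k) (Fin k) ℂ)
        (δ : Fin (n + 1) → Matrix (Fin m) (Fin m) ℂ) (μ : ℝ),
        IsWeakIrreducible A ∧ IsPPT A ∧
        IsHermitianSchmidtDecomposition A lam γ δ ∧ Antitone lam ∧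
        IsLeastPositiveEigenvalue (γ 0 ⊗ₖ δ 0) μ ∧
        l ≤ lam 0 * μ / ∑ i : Fin n, lam i.succ ∧
        ¬ IsSeparableMatrix A) ∧
    -- the explicit family whose separability thresholds approach `1`
    (∀ n : ℕ, 1 ≤ n →
      IsLeastPositiveEigenvalue (normalizedOne n ⊗ₖ normalizedOne n) (1 / ((n : ℝ) + 1)) ∧
      ∀ lam₁ lam₂ : ℝ, 0 < lam₁ → 0 < lam₂ →
        IsHermitianSchmidtDecomposition (diagFamily n lam₁ lam₂) ![lam₁, lam₂]
          ![normalizedOne n, tracelessDiag n] ![normalizedOne n, -tracelessDiag n] ∧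
        (IsSeparableMatrix (diagFamily n lam₁ lam₂) ↔
          (n : ℝ) ^ 2 / ((n : ℝ) ^ 2 + n) ≤ lam₁ * (1 / ((n : ℝ) + 1)) / lam₂)) ∧
    (∀ l : ℝ, 0 < l → l < 1 →
      ∃ n : ℕ, 1 ≤ n ∧ l < (n : ℝ) ^ 2 / ((n : ℝ) ^ 2 + n)) := by
  refine ⟨fun k m n A lam γ δ μ hw hA h hmono hμ hle =>
      hw.isSeparableMatrix_of_sum_le hA h hmono hμ hle,
    fun l hl0 hl1 => exists_entangled_of_lt_one hl0 hl1,
    fun n hn => ⟨isLeastPositiveEigenvalue_normalizedOne n, fun lam₁ lam₂ h₁ h₂ =>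
      ⟨isHermitianSchmidtDecomposition_diagFamily hn h₁ h₂,
        isSeparableMatrix_diagFamily_iff hn h₂⟩⟩,
    fun l _ hl1 => exists_lt_sq_div l hl1⟩
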